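/- **Notation.** Let $\mathbb R^*$ be the multiplicative group of non-zero reals, $\mathbb R^*_+$ its subgroup of positive reals, and $\mathbb T=\mathbb R/\mathbb Z$. Two measures are equivalent ($\sim$) if they have the same null sets. For a measure $\tau$ on $G=\mathbb T$ or $G=\mathbb R$ let $H_G(\tau)$ be the set of all $g\in G$ such that the translate of $\tau$ by $g$ is equivalent to $\tau$; for a measure $\sigma$ on $\mathbb R$ without mass at $0$ let $H_{\mathbb R^*}(\sigma)$ be the set of all $s\in\mathbb R^*$ such that the image of $\sigma$ under $x\mapsto sx$ is equivalent to $\sigma$. A probability measure $\rho$ on $\mathbb T$ is ergodic with respect to $H_{\mathbb T}(\rho)$ if every Borel set that is invariant mod $\rho$ under the translation by each element of $H_{\mathbb T}(\rho)$ is $\rho$-null or $\rho$-conull. A flow $T=(T_t)_{t\in\mathbb R}$ is a jointly measurable measure preserving action of $\mathbb R$ on a standard probability space $(X,\mu)$. Flows $T$ on $(X,\mu)$ and $S$ on $(Y,\nu)$ are isomorphic if there is a measure preserving map $\varphi:X\to Y$, invertible mod null sets, such that for every $t$ one has $\varphi\circ T_t=S_t\circ\varphi$ almost everywhere. Put $$I(T):=\{s\in\mathbb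 R^*\mid (T_{st})_{t\in\mathbb R}\text{ is isomorphic to }T\}.$$ For a symmetric probability measure $\sigma$ on $\mathbb R$, the Gaussian flow associated with $\sigma$ is the (unique up to isomorphism) flow $T$ for which there is a measurable $f:X\to\mathbb R$ such that $(f\circ T_t)_{t\in\mathbb R}$ is a centered Gaussian process with $\int (f\circ T_a)(f\circ T_b)\,d\mu=\int e^{i(b-a)x}\,d\sigma(x)$ for all $a,b\in\mathbb R$, and such that the $\sigma$-algebra generated by this process is, mod null sets, the whole $\sigma$-algebra of $X$. **Proposition 1.1.** Fix a continuous homomorphism $\pi$ from $\mathbb R$ onto $\mathbb T$ and a topological group isomorphism $\vartheta:\mathbb R\to\mathbb R^*_+$. Let $\rho$ be a non-atomic probability measure on $\mathbb T$ such that 1. $H_{\mathbb T}(\rho)$ is uncountable and meager in $\mathbb T$, and 2. $\rho$ is ergodic with respect to $H_{\mathbb T}(\rho)$. Let $\rho'$ be a standard lift of $\rho$, that is, a probability measure on $\mathbb R$ with $\rho'\circ\pi^{-1}\sim\rho$ and $H_{\mathbb R}(\rho')=\pi^{-1}(H_{\mathbb T}(\rho))$, and let $\sigma$ be the non-atomic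 symmetric probability measure on $\mathbb R$ whose restriction to $\mathbb R^*_+$ is $\frac12\rho'\circ\vartheta^{-1}$. Let $T$ be the Gaussian flow associated with $\sigma$. Then $$I(T)\supset H_{\mathbb R^*}(\sigma)\qquad\text{but}\qquad \mathbb R^*_+\not\subset I(T).$$ -/

import Mathlib

open MeasureTheory ProbabilityTheory Set Filter
open scoped ENNReal

namespace GaussianSelfSimilarity

/-! ### Groups of quasi-invariance and ergodicity of translations -/

/-- Two measures are equivalent if they have the same null sets. -/
def MeasureEquiv {X : Type*} [MeasurableSpace X] (μ ν : Measure X) : Prop :=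
  μ ≪ ν ∧ ν ≪ μ

/-- `H_G(τ)` for an additive group `G` (used for the circle `ℝ/ℤ` and for `ℝ`): the set of all `g`
such that the translate of `τ` by `g` is equivalent to `τ`. -/
def quasiInvariance {G : Type*} [AddGroup G] [MeasurableSpace G] (τ : Measure G) : Set G :=
  {g | MeasureEquiv (τ.map (fun x => g + x)) τ}

/-- `H_{ℝ*}(σ)`: the set of all `s ∈ ℝ*` such that the image of `σ` under multiplication by `s` is
equivalent to `σ`.  Here a measure on `ℝ*` is regarded as a measure on `ℝ` giving mass `0` to the
point `0`. -/
def mulQuasiInvariance (σ : Measure ℝ) : Set ℝˣ :=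
  {s | MeasureEquiv (σ.map (fun x => (s : ℝ) * x)) σ}

/-- `τ` is ergodic with respect to the (non-singular) action of `H_G(τ)` by translations: every
measurable set which is invariant mod `τ` under every translation by an element of `H_G(τ)` is
`τ`-null or `τ`-conull. -/
def IsErgodicUnderQuasiInvariance {G : Type*} [AddGroup G] [MeasurableSpace G]
    (τ : Measure G) : Prop :=
  ∀ A : Set G, MeasurableSet A →
    (∀ g ∈ quasiInvariance τ, (fun x => g + x) ⁻¹' A =ᵐ[τ] A) → τ A = 0 ∨ τ Aᶜ = 0

/-! ### The measures `ρ'` and `σ` built from `ρ` -/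

/-- `ρ'` is a standard lift of `ρ` along the homomorphism `π : ℝ → ℝ/ℤ`. -/
structure IsStandardLift (π : ℝ →+ UnitAddCircle) (ρ : Measure UnitAddCircle)
    (ρ' : Measure ℝ) : Prop where
  isProbabilityMeasure : IsProbabilityMeasure ρ'
  map_equiv : MeasureEquiv (ρ'.map π) ρ
  quasiInvariance_eq : quasiInvariance ρ' = π ⁻¹' quasiInvariance ρ

/-- `σ` is the non-atomic symmetric probability measure on `ℝ` whose restriction to the positive
half-line is one half of the image of `ρ'` under `ϑ : ℝ → ℝ*₊`. -/
structure IsSymmetricExtension (ϑ : AddChar ℝ ℝ) (ρ' σ : Measure ℝ) : Prop where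
  isProbabilityMeasure : IsProbabilityMeasure σ
  nonatomic : ∀ x : ℝ, σ {x} = 0
  symmetric : σ.map (fun x => -x) = σ
  restrict_pos : σ.restrict (Ioi 0) = (2 : ℝ≥0∞)⁻¹ • ρ'.map ϑ

/-! ### Flows, isomorphism and self-similarities -/

/-- A (jointly measurable) measure preserving flow `(T_t)_{t ∈ ℝ}` on `(X, μ)`. -/
structure Flow {X : Type*} [MeasurableSpace X] (μ : Measure X) where
  toFun : ℝ → X → X
  measurable_uncurry : Measurable (fun p : ℝ × X => toFun p.1 p.2)
  map_zero : ∀ x, toFun 0 x = x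
  map_add : ∀ s t x, toFun (s + t) x = toFun s (toFun t x)
  measurePreserving : ∀ t, MeasurePreserving (toFun t) μ μ

/-- The flow `T ∘ s = (T_{st})_{t ∈ ℝ}`. -/
def Flow.scale {X : Type*} [MeasurableSpace X] {μ : Measure X} (T : Flow μ) (s : ℝˣ) : Flow μ where
  toFun t := T.toFun ((s : ℝ) * t)
  measurable_uncurry := T.measurable_uncurry.comp
    ((measurable_const.mul measurable_fst).prodMk measurable_snd)
  map_zero x := by rw [mul_zero, T.map_zero]
  map_add a b x := by rw [mul_add, T.map_add]
  measurePreserving t := T.measurePreserving _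

/-- Isomorphism of measure preserving flows: an invertible (mod null sets) measure preserving map
`φ` with `φ ∘ T_t = S_t ∘ φ` almost everywhere, for every `t`. -/
def Flow.Isomorphic {X Y : Type*} [MeasurableSpace X] [MeasurableSpace Y]
    {μ : Measure X} {ν : Measure Y} (T : Flow μ) (S : Flow ν) : Prop :=
  ∃ (φ : X → Y) (ψ : Y → X), MeasurePreserving φ μ ν ∧ MeasurePreserving ψ ν μ ∧
    (∀ᵐ x ∂μ, ψ (φ x) = x) ∧ (∀ᵐ y ∂ν, φ (ψ y) = y) ∧
    ∀ t : ℝ, ∀ᵐ x ∂μ, φ (T.toFun t x) = S.toFun t (φ x)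

/-- `I(T)`, the group of self-similarities of `T`. -/
def Flow.selfSimilarities {X : Type*} [MeasurableSpace X] {μ : Measure X} (T : Flow μ) : Set ℝˣ :=
  {s | (T.scale s).Isomorphic T}

/-! ### Gaussian flows -/

/-- The σ-algebra generated by the process `(f ∘ T_t)_{t ∈ ℝ}`. -/
@[reducible]
def Flow.generatedBy {X : Type*} [MeasurableSpace X] {μ : Measure X} (T : Flow μ) (f : X → ℝ) :
    MeasurableSpace X :=
  ⨆ t : ℝ, MeasurableSpace.comap (fun x => f (T.toFun t x)) (inferInstance : MeasurableSpace ℝ)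

/-- `T` is the Gaussian flow associated with the symmetric finite measure `σ` on `ℝ`: the flow `T`
is generated by a centered stationary real Gaussian process `(f ∘ T_t)_{t ∈ ℝ}` whose spectral
measure is `σ`, i.e. `𝔼[(f ∘ T_a)(f ∘ T_b)] = ∫ exp(i (b - a) x) dσ(x)`.  This determines `T` up
to isomorphism among flows on standard probability spaces. -/
def Flow.IsGaussianFlow {X : Type*} [MeasurableSpace X] {μ : Measure X} (T : Flow μ)
    (σ : Measure ℝ) : Prop :=
  ∃ f : X → ℝ, Measurable f ∧
    IsGaussianProcess (fun (t : ℝ) (x : X) => f (T.toFun t x)) μ ∧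
    (∫ x, f x ∂μ = 0) ∧
    (∀ a b : ℝ, ((∫ x, f (T.toFun a x) * f (T.toFun b x) ∂μ : ℝ) : ℂ) = charFun σ (b - a)) ∧
    ∀ A : Set X, MeasurableSet A → ∃ B : Set X, MeasurableSet[T.generatedBy f] B ∧ A =ᵐ[μ] B

end GaussianSelfSimilarity

/-!
The argument takes place in real `L²` spaces and uses spectral measures only.

*The group `H(σ)` acts by self-similarities.* For a symmetric measure `σ`, the Hartley kernels
`cas (t x) = cos (t x) + sin (t x)` form a total family in the real space `L²(σ)` with Gram matrix
`∫ cos ((b - a) x) dσ`, so `cas (t ·) ↦ f ∘ T_t` extends to an isometry `U` of `L²(σ)` onto the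
Gaussian Hilbert space of the flow. If `s σ ∼ σ` and `k² = d(s σ)/dσ`, then `G = U k` is a vector
whose orbit `G ∘ T_t` has the covariance of `f ∘ T_{st}`, and since `k` has no zeros this orbit still
spans the Gaussian space (`Flow.HasSpectralMeasure.exists_orbit_rescaled`). Elements of the Gaussian
space are centered Gaussian, so the two processes, sampled at rational times, have the same law in
`ℚ → ℝ` (`map_eq_of_inner_eq`). Both generate the σ-algebra of a standard Borel space mod null sets,
hence both sampling maps are invertible mod null sets and composing one with the inverse of the
other gives an automorphism (`exists_automorphism_of_map_eq`), which intertwines `T_{st}` and `T_t`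
by continuity of the orbits in `L²` (`equivariant_of_orbit_eq`).

*Not every positive `s` is a self-similarity.* By ergodicity two translates of `ρ` are equivalent or
mutually singular (`measureEquiv_or_mutuallySingular_map_add`). Since the group `H(ρ)` is meagre, it
has uncountably many cosets by Baire's theorem, hence there are uncountably many pairwise singular
translates of `ρ`, and correspondingly uncountably many pairwise singular dilates of `σ`
(`mutuallySingular_dilates`). If every positive `s` were a self-similarity, then each dilate of `σ`
would be the spectral measure of a unit vector of `L²(μ)`. Vectors with mutually singular spectral
measures are orthogonal (`inner_eq_zero_of_mutuallySingular`), so the separable space `L²(μ)` would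
contain an uncountable orthonormal family.
-/

namespace GaussianSelfSimilarity

/-! ### Equivalence and singularity of translates and dilates -/

lemma MeasureEquiv.symm {X : Type*} [MeasurableSpace X] {μ ν : Measure X}
    (h : MeasureEquiv μ ν) : MeasureEquiv ν μ := ⟨h.2, h.1⟩

lemma MeasureEquiv.trans {X : Type*} [MeasurableSpace X] {μ ν κ : Measure X}
    (h : MeasureEquiv μ ν) (h' : MeasureEquiv ν κ) : MeasureEquiv μ κ :=
  ⟨h.1.trans h'.1, h'.2.trans h.2⟩

lemma MeasureEquiv.map {X Y : Type*} [MeasurableSpace X] [MeasurableSpace Y] {μ ν : Measure X}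
    (h : MeasureEquiv μ ν) {f : X → Y} (hf : Measurable f) :
    MeasureEquiv (μ.map f) (ν.map f) := ⟨h.1.map hf, h.2.map hf⟩

section Translates

variable {G : Type*} [AddCommGroup G] [MeasurableSpace G] [MeasurableAdd G]

lemma map_add_map (τ : Measure G) (a b : G) :
    (τ.map (fun x => a + x)).map (fun x => b + x) = τ.map (fun x => (b + a) + x) := by
  rw [Measure.map_map (measurable_const_add b) (measurable_const_add a)]
  congr 1
  ext x
  simp [add_assoc]

lemma neg_mem_quasiInvariance {τ : Measure G} {g : G} (hg : g ∈ quasiInvariance τ) :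
    -g ∈ quasiInvariance τ := by
  have h := MeasureEquiv.map (f := fun x => -g + x) hg (measurable_const_add (-g))
  rw [map_add_map, neg_add_cancel] at h
  simp only [zero_add, Measure.map_id'] at h
  exact h.symm

/-- The zero-one law behind the dichotomy for translates: the part of `τ` that is singular to the
translate `τ_c` is invariant under the translations that preserve the class of `τ`, because these
also preserve the class of `τ_c`. -/
lemma absolutelyContinuous_or_mutuallySingular_map_add {τ : Measure G} [IsFiniteMeasure τ]
    (hτ : IsErgodicUnderQuasiInvariance τ) (c : G) :
    τ ≪ τ.map (fun x => c + x) ∨ τ ⟂ₘ τ.map (fun x => c + x) := by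
  set κ := τ.map (fun x => c + x) with hκ
  have hsing := Measure.mutuallySingular_singularPart τ κ
  obtain ⟨N, hN, hN1, hN2⟩ := hsing
  set A : Set G := Nᶜ with hA
  have hAm : MeasurableSet A := hN.compl
  have hac : ∀ S : Set G, κ S = 0 → τ (S \ A) = 0 := by
    intro S hS
    have h1 : τ.singularPart κ (S \ A) = 0 :=
      measure_mono_null (fun x hx => by simpa [hA] using hx.2) hN1
    have h2 : κ.withDensity (τ.rnDeriv κ) (S \ A) = 0 :=
      withDensity_absolutelyContinuous κ _ (measure_mono_null sdiff_subset hS)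
    rw [Measure.haveLebesgueDecomposition_add τ κ]
    simp [h1, h2]
  have key : ∀ g ∈ quasiInvariance τ, τ ((fun x => g + x) ⁻¹' A \ A) = 0 := by
    intro g hg
    apply hac
    have h1 : (κ.map (fun x => g + x)) ≪ κ := by
      have h := hg.1.map (measurable_const_add c)
      rwa [map_add_map, add_comm c g, ← map_add_map] at h
    have h2 := h1 hN2
    rwa [Measure.map_apply (measurable_const_add g) hAm] at h2
  have hinv : ∀ g ∈ quasiInvariance τ, (fun x => g + x) ⁻¹' A =ᵐ[τ] A := by
    intro g hg
    have h1 : τ (A \ (fun x => g + x) ⁻¹' A) = 0 := by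
      have h2 := hg.1 (key (-g) (neg_mem_quasiInvariance hg))
      have hm : MeasurableSet ((fun x => -g + x) ⁻¹' A \ A) :=
        ((measurable_const_add (-g)) hAm).diff hAm
      rw [Measure.map_apply (measurable_const_add g) hm] at h2
      convert h2 using 2
      ext x
      simp
    exact (ae_eq_set).2 ⟨key g hg, h1⟩
  rcases hτ A hAm hinv with h | h
  · left
    intro S hS
    have := hac S hS
    exact measure_mono_null (fun x hx => by
      by_cases hxA : x ∈ A
      · exact Or.inr hxA
      · exact Or.inl ⟨hx, hxA⟩) (measure_union_null this h)
  · right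
    exact ⟨Aᶜ, hAm.compl, h, by simpa [hA] using hN2⟩

lemma mutuallySingular_map_add {τ κ : Measure G} (h : τ ⟂ₘ κ) (c : G) :
    τ.map (fun x => c + x) ⟂ₘ κ.map (fun x => c + x) := by
  obtain ⟨N, hN, h1, h2⟩ := h
  have hm := measurable_const_add (M := G) (-c)
  refine ⟨(fun x => -c + x) ⁻¹' N, hm hN, ?_, ?_⟩
  · rw [Measure.map_apply (measurable_const_add c) (hm hN)]
    simpa [← preimage_comp, Function.comp_def] using h1
  · rw [Measure.map_apply (measurable_const_add c) (hm hN).compl]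
    simpa [← preimage_comp, Function.comp_def, ← preimage_compl] using h2

lemma measureEquiv_or_mutuallySingular_map_add {τ : Measure G} [IsFiniteMeasure τ]
    (hτ : IsErgodicUnderQuasiInvariance τ) (a b : G) :
    MeasureEquiv (τ.map (fun x => a + x)) (τ.map (fun x => b + x)) ∨
      τ.map (fun x => a + x) ⟂ₘ τ.map (fun x => b + x) := by
  have e1 : (τ.map (fun x => (b - a) + x)).map (fun x => a + x) = τ.map (fun x => b + x) := by
    rw [map_add_map]; simp
  have e2 : (τ.map (fun x => (a - b) + x)).map (fun x => b + x) = τ.map (fun x => a + x) := by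
    rw [map_add_map]; simp
  rcases absolutelyContinuous_or_mutuallySingular_map_add hτ (b - a) with h | h
  · rcases absolutelyContinuous_or_mutuallySingular_map_add hτ (a - b) with h' | h'
    · left
      constructor
      · simpa only [e1] using h.map (measurable_const_add a)
      · simpa only [e2] using h'.map (measurable_const_add b)
    · right
      have := mutuallySingular_map_add h' b
      rw [e2] at this
      exact this.symm
  · right
    have := mutuallySingular_map_add h a
    rwa [e1] at this

lemma sub_mem_quasiInvariance_of_measureEquiv {τ : Measure G} {a b : G}
    (h : MeasureEquiv (τ.map (fun x => a + x)) (τ.map (fun x => b + x))) :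
    a - b ∈ quasiInvariance τ := by
  have := MeasureEquiv.map h (measurable_const_add (-b))
  rw [map_add_map, map_add_map, neg_add_cancel] at this
  simp only [zero_add, Measure.map_id'] at this
  rwa [sub_eq_neg_add]

end Translates

lemma mutuallySingular_of_map {X Y : Type*} [MeasurableSpace X] [MeasurableSpace Y]
    {μ ν : Measure X} {f : X → Y} (hf : Measurable f) (h : μ.map f ⟂ₘ ν.map f) : μ ⟂ₘ ν := by
  obtain ⟨N, hN, h1, h2⟩ := h
  rw [Measure.map_apply hf hN] at h1
  rw [Measure.map_apply hf hN.compl] at h2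
  exact ⟨f ⁻¹' N, hf hN, h1, h2⟩

lemma mutuallySingular_map_of_measurableEmbedding {X Y : Type*} [MeasurableSpace X]
    [MeasurableSpace Y] {μ ν : Measure X} {f : X → Y} (hf : MeasurableEmbedding f)
    (h : μ ⟂ₘ ν) : μ.map f ⟂ₘ ν.map f := by
  obtain ⟨N, hN, h1, h2⟩ := h
  refine ⟨f '' N, hf.measurableSet_image.2 hN, ?_, ?_⟩
  · rw [hf.map_apply, preimage_image_eq _ hf.injective, h1]
  · rw [hf.map_apply, preimage_compl, preimage_image_eq _ hf.injective, h2]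

lemma map_const_mul_neg {σ : Measure ℝ} (hσ : σ.map (fun x => -x) = σ) (c : ℝ) :
    (σ.map (fun x => c * x)).map (fun x => -x) = σ.map (fun x => c * x) := by
  conv_rhs => rw [← hσ]
  rw [Measure.map_map measurable_neg (measurable_const_mul c),
    Measure.map_map (measurable_const_mul c) measurable_neg]
  congr 1
  ext x
  simp

/-- Symmetric measures without mass at `0` are singular as soon as their restrictions to the
positive half-line are. -/
lemma mutuallySingular_of_restrict_Ioi {α β : Measure ℝ} (hα : α.map (fun x => -x) = α)
    (hβ : β.map (fun x => -x) = β) (h0 : α {0} = 0)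
    (h : α.restrict (Ioi 0) ⟂ₘ β.restrict (Ioi 0)) : α ⟂ₘ β := by
  obtain ⟨N, hN, h1, h2⟩ := h
  rw [Measure.restrict_apply hN] at h1
  rw [Measure.restrict_apply hN.compl] at h2
  have hm1 : MeasurableSet (N ∩ Ioi 0) := hN.inter measurableSet_Ioi
  have hm2 : MeasurableSet (Nᶜ ∩ Ioi 0) := hN.compl.inter measurableSet_Ioi
  have h1' : α ((fun x => -x) ⁻¹' (N ∩ Ioi 0)) = 0 := by
    rw [← Measure.map_apply measurable_neg hm1, hα, h1]
  have h2' : β ((fun x => -x) ⁻¹' (Nᶜ ∩ Ioi 0)) = 0 := by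
    rw [← Measure.map_apply measurable_neg hm2, hβ, h2]
  refine ⟨(N ∩ Ioi 0) ∪ (fun x => -x) ⁻¹' (N ∩ Ioi 0) ∪ {0},
    (hm1.union (measurable_neg hm1)).union (measurableSet_singleton 0),
    measure_union_null (measure_union_null h1 h1') h0, ?_⟩
  refine measure_mono_null ?_ (measure_union_null h2 h2')
  intro x hx
  simp only [mem_compl_iff, mem_union, mem_inter_iff, mem_Ioi, mem_preimage, mem_singleton_iff,
    not_or, not_and] at hx ⊢
  rcases lt_trichotomy x 0 with hlt | heq | hgt
  · right
    have : 0 < -x := by linarith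
    exact ⟨fun h => hx.1.2 h this, this⟩
  · exact absurd heq hx.2
  · left
    exact ⟨fun h => hx.1.1 h hgt, hgt⟩

section Dilates

variable {π : ℝ →+ UnitAddCircle} {ϑ : AddChar ℝ ℝ} {ρ : Measure UnitAddCircle}
  {ρ' σ : Measure ℝ}

lemma restrict_Ioi_map_const_mul (hϑ : Measurable ϑ) (hpos : ∀ u, 0 < ϑ u)
    (hσ : IsSymmetricExtension ϑ ρ' σ) (u : ℝ) :
    (σ.map (fun x => ϑ u * x)).restrict (Ioi 0)
      = (2 : ℝ≥0∞)⁻¹ • (ρ'.map (fun x => u + x)).map ϑ := by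
  have hm := measurable_const_mul (ϑ u)
  rw [Measure.restrict_map hm measurableSet_Ioi]
  have : (fun x => ϑ u * x) ⁻¹' Ioi 0 = Ioi 0 := by
    ext x
    simp [hpos u]
  rw [this, hσ.restrict_pos, Measure.map_smul, Measure.map_map hm hϑ,
    Measure.map_map hϑ (measurable_const_add u)]
  congr 2
  ext x
  simp [AddChar.map_add_eq_mul]

lemma mutuallySingular_dilates (hπ : Continuous π) (hϑ_cont : Continuous ϑ)
    (hϑ_bij : Set.BijOn ϑ Set.univ (Set.Ioi 0)) (hρ' : IsStandardLift π ρ ρ')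
    (hσ : IsSymmetricExtension ϑ ρ' σ) {u v : ℝ}
    (h : ρ.map (fun x => π u + x) ⟂ₘ ρ.map (fun x => π v + x)) :
    σ.map (fun x => ϑ u * x) ⟂ₘ σ.map (fun x => ϑ v * x) := by
  have hinj : Function.Injective ϑ := fun x y hxy => hϑ_bij.injOn (mem_univ _) (mem_univ _) hxy
  have hpos : ∀ u, 0 < ϑ u := fun u => hϑ_bij.mapsTo (mem_univ u)
  have hcomm : ∀ w, (ρ'.map (fun x => w + x)).map π ≪ ρ.map (fun x => π w + x) := by
    intro w
    have h1 := hρ'.map_equiv.1.map (measurable_const_add (π w))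
    rw [Measure.map_map (measurable_const_add _) hπ.measurable] at h1
    rw [Measure.map_map hπ.measurable (measurable_const_add _)]
    convert h1 using 2
    ext x
    simp
  have h1 : (ρ'.map (fun x => u + x)) ⟂ₘ (ρ'.map (fun x => v + x)) :=
    mutuallySingular_of_map hπ.measurable (h.mono_ac (hcomm u) (hcomm v))
  have h2 := mutuallySingular_map_of_measurableEmbedding
    (hϑ_cont.measurableEmbedding hinj) h1
  apply mutuallySingular_of_restrict_Ioi (map_const_mul_neg hσ.symmetric _)
    (map_const_mul_neg hσ.symmetric _)
  · rw [Measure.map_apply (measurable_const_mul _) (measurableSet_singleton 0)]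
    convert hσ.nonatomic 0 using 2
    ext x
    simp [(hpos u).ne']
  · rw [restrict_Ioi_map_const_mul hϑ_cont.measurable hpos hσ,
      restrict_Ioi_map_const_mul hϑ_cont.measurable hpos hσ]
    exact h2.mono_ac Measure.smul_absolutelyContinuous Measure.smul_absolutelyContinuous

end Dilates

/-! ### The Hartley kernel in the real space `L²(σ)` -/

/-- The Hartley kernel `cas (t x) = cos (t x) + sin (t x)`. For a symmetric measure it plays in the
real space `L²` the role that the character `exp (i t x)` plays in the complex one. -/
noncomputable def cas (t x : ℝ) : ℝ := Real.cos (t * x) + Real.sin (t * x)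

lemma continuous_cas (t : ℝ) : Continuous (cas t) := by unfold cas; fun_prop

lemma norm_cas_le (t x : ℝ) : ‖cas t x‖ ≤ 2 := by
  unfold cas
  rw [Real.norm_eq_abs, abs_le]
  constructor <;> linarith [Real.neg_one_le_cos (t * x), Real.cos_le_one (t * x),
    Real.neg_one_le_sin (t * x), Real.sin_le_one (t * x)]

lemma cas_mul_cas (a b x : ℝ) :
    cas a x * cas b x = Real.cos ((b - a) * x) + Real.sin ((a + b) * x) := by
  rw [sub_mul, add_mul, Real.cos_sub, Real.sin_add, cas, cas]
  ring

lemma memLp_cas (σ : Measure ℝ) [IsFiniteMeasure σ] (t : ℝ) : MemLp (cas t) 2 σ :=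
  MemLp.of_bound (continuous_cas t).aestronglyMeasurable 2 (ae_of_all _ (norm_cas_le t))

/-- The Hartley kernel as an element of `L²(σ)`. -/
noncomputable def casLp (σ : Measure ℝ) [IsFiniteMeasure σ] (t : ℝ) : Lp ℝ 2 σ :=
  (memLp_cas σ t).toLp

lemma integral_eq_zero_of_odd {σ : Measure ℝ} (hσ : σ.map (fun x => -x) = σ) {F : ℝ → ℝ}
    (hF : ∀ᵐ x ∂σ, F (-x) = -F x) : ∫ x, F x ∂σ = 0 := by
  have h1 : ∫ x, F x ∂σ = ∫ x, F (-x) ∂σ := by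
    conv_lhs => rw [← hσ]
    exact (MeasurableEquiv.neg ℝ).measurableEmbedding.integral_map F
  rw [integral_congr_ae hF, integral_neg] at h1
  linarith

lemma integrable_cos_const_mul (σ : Measure ℝ) [IsFiniteMeasure σ] (t : ℝ) :
    Integrable (fun x => Real.cos (t * x)) σ :=
  Integrable.of_bound (by fun_prop) 1 (ae_of_all _ fun x => Real.abs_cos_le_one _)

lemma integrable_sin_const_mul (σ : Measure ℝ) [IsFiniteMeasure σ] (t : ℝ) :
    Integrable (fun x => Real.sin (t * x)) σ :=
  Integrable.of_bound (by fun_prop) 1 (ae_of_all _ fun x => Real.abs_sin_le_one _)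

lemma integral_cas_mul_cas {σ : Measure ℝ} [IsFiniteMeasure σ]
    (hσ : σ.map (fun x => -x) = σ) (a b : ℝ) :
    ∫ x, cas a x * cas b x ∂σ = ∫ x, Real.cos ((b - a) * x) ∂σ := by
  simp_rw [cas_mul_cas]
  rw [integral_add (integrable_cos_const_mul σ _) (integrable_sin_const_mul σ _),
    integral_eq_zero_of_odd hσ (F := fun x => Real.sin ((a + b) * x)), add_zero]
  exact ae_of_all _ fun x => by simp

lemma inner_casLp {σ : Measure ℝ} [IsFiniteMeasure σ] (hσ : σ.map (fun x => -x) = σ) (a b : ℝ) :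
    inner ℝ (casLp σ a) (casLp σ b) = ∫ x, Real.cos ((b - a) * x) ∂σ := by
  rw [← integral_cas_mul_cas hσ, L2.inner_def]
  apply integral_congr_ae
  filter_upwards [(memLp_cas σ a).coeFn_toLp, (memLp_cas σ b).coeFn_toLp] with x h1 h2
  simp only [casLp, h1, h2, real_inner_eq_re_inner]
  simp [mul_comm]

lemma charFun_re (σ : Measure ℝ) [IsFiniteMeasure σ] (t : ℝ) :
    (charFun σ t).re = ∫ x, Real.cos (t * x) ∂σ := by
  rw [charFun_apply_real, ← RCLike.re_eq_complex_re, ← integral_re]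
  · congr 1
    ext x
    rw [RCLike.re_eq_complex_re, ← Complex.ofReal_mul, Complex.exp_ofReal_mul_I_re]
  · refine Integrable.of_bound (by fun_prop) 1 (ae_of_all _ fun x => ?_)
    rw [← Complex.ofReal_mul, Complex.norm_exp_ofReal_mul_I]

/-- Injectivity of the Hartley transform: the transforms of the positive and of the negative part of
`h σ` coincide, so these measures do. -/
lemma ae_eq_zero_of_integral_mul_cas {σ : Measure ℝ} [IsFiniteMeasure σ] {h : ℝ → ℝ}
    (hm : Measurable h) (hi : Integrable h σ) (h0 : ∀ t, ∫ x, h x * cas t x ∂σ = 0) :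
    h =ᵐ[σ] 0 := by
  have hic : ∀ t, Integrable (fun x => h x * Real.cos (t * x)) σ := fun t =>
    hi.mul_bdd (c := 1) (by fun_prop) (ae_of_all _ fun x => Real.abs_cos_le_one _)
  have his : ∀ t, Integrable (fun x => h x * Real.sin (t * x)) σ := fun t =>
    hi.mul_bdd (c := 1) (by fun_prop) (ae_of_all _ fun x => Real.abs_sin_le_one _)
  have hplus : ∀ t, ∫ x, h x * Real.cos (t * x) ∂σ + ∫ x, h x * Real.sin (t * x) ∂σ = 0 := by
    intro t
    rw [← integral_add (hic t) (his t), ← h0 t]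
    simp only [cas, mul_add]
  have hcs : ∀ t, ∫ x, h x * Real.cos (t * x) ∂σ = 0 ∧ ∫ x, h x * Real.sin (t * x) ∂σ = 0 := by
    intro t
    have h1 := hplus t
    have h2 := hplus (-t)
    simp only [neg_mul, Real.cos_neg, Real.sin_neg, mul_neg, integral_neg] at h2
    constructor <;> linarith
  have hexp : ∀ t : ℝ, ∫ x, (h x : ℂ) * Complex.exp (t * x * Complex.I) ∂σ = 0 := by
    intro t
    have e : ∀ x : ℝ, (h x : ℂ) * Complex.exp (t * x * Complex.I)
        = ((h x * Real.cos (t * x) : ℝ) : ℂ) + ((h x * Real.sin (t * x) : ℝ) : ℂ) * Complex.I := by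
      intro x
      rw [Complex.exp_mul_I]
      push_cast
      ring
    simp_rw [e]
    rw [integral_add (hic t).ofReal ((his t).ofReal.mul_const _), integral_mul_const,
      integral_complex_ofReal, integral_complex_ofReal, (hcs t).1, (hcs t).2]
    simp
  have hfin : ∀ g : ℝ → ℝ, Integrable g σ →
      IsFiniteMeasure (σ.withDensity (fun x => ENNReal.ofReal (g x))) := fun g hg =>
    isFiniteMeasure_withDensity_ofReal hg.2
  have := hfin h hi
  have := hfin (fun x => - h x) hi.neg
  have hchar : ∀ g : ℝ → ℝ, Measurable g → ∀ t : ℝ,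
      charFun (σ.withDensity (fun x => ENNReal.ofReal (g x))) t
        = ∫ x, ((max (g x) 0 : ℝ) : ℂ) * Complex.exp (t * x * Complex.I) ∂σ := by
    intro g hg t
    rw [charFun_apply_real, integral_withDensity_eq_integral_toReal_smul hg.ennreal_ofReal
      (ae_of_all _ fun x => ENNReal.ofReal_lt_top)]
    simp [ENNReal.toReal_ofReal']
  have hmeas : σ.withDensity (fun x => ENNReal.ofReal (h x))
      = σ.withDensity (fun x => ENNReal.ofReal (- h x)) := by
    apply Measure.ext_of_charFun
    ext t
    rw [hchar h hm, hchar (fun x => - h x) hm.neg, ← sub_eq_zero, ← integral_sub]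
    · rw [← hexp t]
      congr 1
      ext x
      rw [← sub_mul, ← Complex.ofReal_sub]
      congr 2
      rcases le_total (h x) 0 with hx | hx <;> simp [hx]
    · exact hi.pos_part.ofReal.mul_bdd (c := 1) (by fun_prop) (ae_of_all _ fun x => by
        rw [← Complex.ofReal_mul, Complex.norm_exp_ofReal_mul_I])
    · exact hi.neg.pos_part.ofReal.mul_bdd (c := 1) (by fun_prop) (ae_of_all _ fun x => by
        rw [← Complex.ofReal_mul, Complex.norm_exp_ofReal_mul_I])
  rw [withDensity_eq_iff hm.ennreal_ofReal.aemeasurable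
    (Measurable.ennreal_ofReal (f := fun x => - h x) hm.neg).aemeasurable
    hi.lintegral_lt_top.ne] at hmeas
  filter_upwards [hmeas] with x hx
  simp only [Pi.zero_apply]
  rcases le_total (h x) 0 with h1 | h1
  · rw [ENNReal.ofReal_of_nonpos h1, eq_comm, ENNReal.ofReal_eq_zero] at hx
    linarith
  · rw [ENNReal.ofReal_of_nonpos (p := - h x) (by linarith), ENNReal.ofReal_eq_zero] at hx
    linarith

lemma memLp_mul_cas {σ : Measure ℝ} {k : ℝ → ℝ} (hk : MemLp k 2 σ) (t : ℝ) :
    MemLp (fun x => k x * cas t x) 2 σ := by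
  refine MemLp.of_le (hk.const_mul 2)
    (hk.1.mul (continuous_cas t).aestronglyMeasurable) (ae_of_all _ fun x => ?_)
  rw [norm_mul, norm_mul, Real.norm_two, mul_comm]
  exact mul_le_mul_of_nonneg_right (norm_cas_le t x) (norm_nonneg _)

/-- A function of `L²(σ)` without zeros is cyclic for the Hartley kernels. -/
lemma topologicalClosure_span_mul_cas {σ : Measure ℝ} [IsFiniteMeasure σ] {k : ℝ → ℝ}
    (hk : MemLp k 2 σ) (hkm : Measurable k) (hk0 : ∀ᵐ x ∂σ, k x ≠ 0) :
    (Submodule.span ℝ (range fun t => (memLp_mul_cas hk t).toLp)).topologicalClosure = ⊤ := by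
  rw [Submodule.topologicalClosure_eq_top_iff, Submodule.eq_bot_iff]
  intro h hh
  rw [Submodule.mem_orthogonal] at hh
  have hhm : Measurable (h : ℝ → ℝ) := (Lp.stronglyMeasurable h).measurable
  have h0 : (fun x => h x * k x) =ᵐ[σ] 0 := by
    apply ae_eq_zero_of_integral_mul_cas (hhm.mul hkm) ((Lp.memLp h).integrable_mul hk)
    intro t
    rw [← hh _ (Submodule.subset_span ⟨t, rfl⟩), L2.inner_def]
    apply integral_congr_ae
    filter_upwards [(memLp_mul_cas hk t).coeFn_toLp] with x hx
    rw [hx]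
    simp
    ring
  rw [Lp.eq_zero_iff_ae_eq_zero]
  filter_upwards [h0, hk0] with x h1 h2
  exact (mul_eq_zero.1 h1).resolve_right h2

lemma topologicalClosure_span_casLp (σ : Measure ℝ) [IsFiniteMeasure σ] :
    (Submodule.span ℝ (range (casLp σ))).topologicalClosure = ⊤ := by
  have := topologicalClosure_span_mul_cas (memLp_const (1 : ℝ) : MemLp (fun _ => (1 : ℝ)) 2 σ)
    measurable_const (ae_of_all _ fun _ => one_ne_zero)
  simp only [one_mul] at this
  exact this

/-! ### Families of vectors with a given Gram matrix -/

section Gram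

variable {ι E F : Type*} [NormedAddCommGroup E] [InnerProductSpace ℝ E]
  [NormedAddCommGroup F] [InnerProductSpace ℝ F]

lemma norm_linearCombination_eq {v : ι → E} {w : ι → F}
    (h : ∀ i j, inner ℝ (v i) (v j) = inner ℝ (w i) (w j)) (c : ι →₀ ℝ) :
    ‖Finsupp.linearCombination ℝ v c‖ = ‖Finsupp.linearCombination ℝ w c‖ := by
  rw [← sq_eq_sq₀ (norm_nonneg _) (norm_nonneg _), ← real_inner_self_eq_norm_sq,
    ← real_inner_self_eq_norm_sq]
  simp only [Finsupp.linearCombination_apply, Finsupp.sum, sum_inner, inner_sum,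
    real_inner_smul_left, real_inner_smul_right, h]

lemma denseRange_linearCombination {v : ι → E}
    (hv : (Submodule.span ℝ (range v)).topologicalClosure = ⊤) :
    DenseRange (Finsupp.linearCombination ℝ v) := by
  rw [DenseRange, ← LinearMap.coe_range, Finsupp.range_linearCombination]
  exact (Submodule.dense_iff_topologicalClosure_eq_top).2 hv

lemma exists_linearIsometry_of_inner_eq [CompleteSpace F] {v : ι → E} {w : ι → F}
    (h : ∀ i j, inner ℝ (v i) (v j) = inner ℝ (w i) (w j))
    (hv : (Submodule.span ℝ (range v)).topologicalClosure = ⊤) :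
    ∃ U : E →ₗᵢ[ℝ] F, ∀ i, U (v i) = w i := by
  have hd := denseRange_linearCombination hv
  have hn : ∀ c, ‖Finsupp.linearCombination ℝ w c‖ ≤ 1 * ‖Finsupp.linearCombination ℝ v c‖ := by
    intro c
    rw [one_mul, norm_linearCombination_eq h]
  let U := (Finsupp.linearCombination ℝ w).extendOfNorm (Finsupp.linearCombination ℝ v)
  have hU : ∀ c, U (Finsupp.linearCombination ℝ v c) = Finsupp.linearCombination ℝ w c :=
    LinearMap.extendOfNorm_eq hd ⟨1, hn⟩
  refine ⟨⟨U.toLinearMap, fun x => ?_⟩, fun i => ?_⟩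
  · refine hd.induction_on (p := fun x => ‖U x‖ = ‖x‖) x ?_ ?_
    · exact isClosed_eq (by fun_prop) continuous_norm
    · intro c
      rw [hU, norm_linearCombination_eq h]
  · have := hU (Finsupp.single i 1)
    simpa using this

lemma linearIsometry_apply_mem_topologicalClosure_span {v : ι → E} {w : ι → F}
    (hv : (Submodule.span ℝ (range v)).topologicalClosure = ⊤) {U : E →ₗᵢ[ℝ] F}
    (hU : ∀ i, U (v i) = w i) (x : E) :
    U x ∈ (Submodule.span ℝ (range w)).topologicalClosure := by
  have hd := denseRange_linearCombination hv
  refine hd.induction_on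
    (p := fun x => U x ∈ (Submodule.span ℝ (range w)).topologicalClosure) x ?_ ?_
  · exact (Submodule.isClosed_topologicalClosure _).preimage U.continuous
  · intro c
    apply Submodule.le_topologicalClosure
    rw [Finsupp.linearCombination_apply, Finsupp.sum, map_sum]
    refine Submodule.sum_mem _ fun i _ => ?_
    rw [map_smul, hU]
    exact Submodule.smul_mem _ _ (Submodule.subset_span ⟨i, rfl⟩)

lemma eq_of_inner_eq_of_mem_topologicalClosure_span {w : ι → F} {x y : F}
    (hx : x ∈ (Submodule.span ℝ (range w)).topologicalClosure)
    (hy : y ∈ (Submodule.span ℝ (range w)).topologicalClosure)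
    (h : ∀ i, inner ℝ (w i) x = inner ℝ (w i) y) : x = y := by
  have h1 : x - y ∈ ((Submodule.span ℝ (range w)).topologicalClosure)ᗮ := by
    rw [Submodule.orthogonal_closure, Submodule.mem_orthogonal]
    intro u hu
    induction hu using Submodule.span_induction with
    | mem u hu =>
      obtain ⟨i, rfl⟩ := hu
      rw [inner_sub_right, h, sub_self]
    | zero => simp
    | add a b _ _ ha hb => rw [inner_add_left, ha, hb, add_zero]
    | smul c a _ ha => rw [real_inner_smul_left, ha, mul_zero]
  have h2 := (Submodule.mem_orthogonal _ _).1 h1 _ (Submodule.sub_mem _ hx hy)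
  exact sub_eq_zero.1 (inner_self_eq_zero.1 h2)

end Gram

/-! ### Singular spectral measures and orthogonality -/

/-- If `α` and `β` are orthogonal families and `α 0` is approximated by combinations of the vectors
`α t + β t`, then the same coefficients approximate `v 0` along `v` and `0` along `w`, so that
stationarity forces `v 0 ⟂ w 0`. -/
lemma inner_eq_zero_of_gram {H K : Type*} [NormedAddCommGroup H] [InnerProductSpace ℝ H]
    [NormedAddCommGroup K] [InnerProductSpace ℝ K] {v w : ℝ → H} {α β : ℝ → K}
    (hv : ∀ a b, inner ℝ (v a) (v b) = inner ℝ (α a) (α b))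
    (hw : ∀ a b, inner ℝ (w (-a)) (w (-b)) = inner ℝ (β a) (β b))
    (hαβ : ∀ a b, inner ℝ (α a) (β b) = 0)
    (hα : α 0 ∈ (Submodule.span ℝ (range fun t => α t + β t)).topologicalClosure)
    (hvw : ∀ a b, inner ℝ (v a) (w b) = inner ℝ (v 0) (w (b - a))) :
    inner ℝ (v 0) (w 0) = 0 := by
  have hbound : ∀ c : ℝ →₀ ℝ, |inner ℝ (v 0) (w 0)| ≤
      ‖Finsupp.linearCombination ℝ (fun t => α t + β t) c - α 0‖ * (‖v 0‖ + ‖w 0‖) := by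
    intro c
    set d := Finsupp.linearCombination ℝ (fun t => α t + β t) c - α 0 with hd
    set d₁ := Finsupp.linearCombination ℝ α (c - Finsupp.single 0 1) with hd₁
    set d₂ := Finsupp.linearCombination ℝ β c with hd₂
    have hsum : d = d₁ + d₂ := by
      rw [hd, hd₁, hd₂, map_sub, Finsupp.linearCombination_single, one_smul]
      simp only [Finsupp.linearCombination_apply, Finsupp.sum, smul_add, Finset.sum_add_distrib]
      abel
    have horth : inner ℝ d₁ d₂ = 0 := by
      rw [hd₁, hd₂]
      simp only [Finsupp.linearCombination_apply, Finsupp.sum, sum_inner, inner_sum,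
        real_inner_smul_left, real_inner_smul_right, hαβ]
      simp
    have hsq : ‖d‖ * ‖d‖ = ‖d₁‖ * ‖d₁‖ + ‖d₂‖ * ‖d₂‖ := by
      rw [hsum]
      exact norm_add_sq_eq_norm_sq_add_norm_sq_real horth
    have h1 : ‖d₁‖ ≤ ‖d‖ := by nlinarith [norm_nonneg d, norm_nonneg d₁, norm_nonneg d₂]
    have h2 : ‖d₂‖ ≤ ‖d‖ := by nlinarith [norm_nonneg d, norm_nonneg d₁, norm_nonneg d₂]
    set e₁ := Finsupp.linearCombination ℝ v (c - Finsupp.single 0 1) with he₁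
    set e₂ := Finsupp.linearCombination ℝ (fun t => w (-t)) c with he₂
    have h1' : ‖e₁‖ = ‖d₁‖ := norm_linearCombination_eq hv _
    have h2' : ‖e₂‖ = ‖d₂‖ := norm_linearCombination_eq hw _
    have hmove : inner ℝ (Finsupp.linearCombination ℝ v c) (w 0) = inner ℝ (v 0) e₂ := by
      rw [he₂]
      simp only [Finsupp.linearCombination_apply, Finsupp.sum, sum_inner, inner_sum,
        real_inner_smul_left, real_inner_smul_right]
      refine Finset.sum_congr rfl fun t _ => ?_
      rw [hvw t 0, zero_sub]
    have hdec : inner ℝ (v 0) (w 0) = inner ℝ (v 0) e₂ - inner ℝ e₁ (w 0) := by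
      rw [he₁, map_sub, inner_sub_left, hmove, Finsupp.linearCombination_single, one_smul]
      ring
    rw [hdec]
    calc |inner ℝ (v 0) e₂ - inner ℝ e₁ (w 0)|
        ≤ |inner ℝ (v 0) e₂| + |inner ℝ e₁ (w 0)| := abs_sub _ _
      _ ≤ ‖v 0‖ * ‖e₂‖ + ‖e₁‖ * ‖w 0‖ :=
          add_le_add (abs_real_inner_le_norm _ _) (abs_real_inner_le_norm _ _)
      _ ≤ ‖v 0‖ * ‖d‖ + ‖d‖ * ‖w 0‖ := by
          rw [h1', h2']
          gcongr
      _ = ‖d‖ * (‖v 0‖ + ‖w 0‖) := by ring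
  have hle : ∀ y ∈ (Submodule.span ℝ (range fun t => α t + β t)).topologicalClosure,
      |inner ℝ (v 0) (w 0)| ≤ ‖y - α 0‖ * (‖v 0‖ + ‖w 0‖) := by
    intro y hy
    rw [← SetLike.mem_coe, Submodule.topologicalClosure_coe] at hy
    refine closure_minimal (t := {y | |inner ℝ (v 0) (w 0)| ≤ ‖y - α 0‖ * (‖v 0‖ + ‖w 0‖)}) ?_
      (isClosed_le continuous_const (by fun_prop)) hy
    intro z hz
    rw [SetLike.mem_coe, ← Finsupp.range_linearCombination] at hz
    obtain ⟨c, rfl⟩ := hz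
    exact hbound c
  have := hle _ hα
  rw [sub_self, norm_zero, zero_mul] at this
  exact abs_nonpos_iff.1 this

/-- Two stationary families of vectors with mutually singular spectral measures are orthogonal. -/
lemma inner_eq_zero_of_mutuallySingular {H : Type*} [NormedAddCommGroup H] [InnerProductSpace ℝ H]
    {σ₁ σ₂ : Measure ℝ} [IsFiniteMeasure σ₁] [IsFiniteMeasure σ₂]
    (h₁ : σ₁.map (fun x => -x) = σ₁) (h₂ : σ₂.map (fun x => -x) = σ₂) (hs : σ₁ ⟂ₘ σ₂)
    {v w : ℝ → H}
    (hv : ∀ a b, inner ℝ (v a) (v b) = ∫ x, Real.cos ((b - a) * x) ∂σ₁)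
    (hw : ∀ a b, inner ℝ (w a) (w b) = ∫ x, Real.cos ((b - a) * x) ∂σ₂)
    (hvw : ∀ a b, inner ℝ (v a) (w b) = inner ℝ (v 0) (w (b - a))) :
    inner ℝ (v 0) (w 0) = 0 := by
  obtain ⟨N, hN, hN1, hN2⟩ := hs
  set ν := σ₁ + σ₂ with hν
  have hr1 : ν.restrict Nᶜ = σ₁ := by
    rw [hν, Measure.restrict_add, Measure.restrict_eq_zero.2 hN2, add_zero]
    exact Measure.restrict_eq_self_of_ae_mem (measure_eq_zero_iff_ae_notMem.1 hN1)
  have hr2 : ν.restrict N = σ₂ := by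
    rw [hν, Measure.restrict_add, Measure.restrict_eq_zero.2 hN1, zero_add]
    refine Measure.restrict_eq_self_of_ae_mem ?_
    filter_upwards [measure_eq_zero_iff_ae_notMem.1 hN2] with x hx
    simpa using hx
  have hmem : ∀ {S : Set ℝ}, MeasurableSet S → ∀ t, MemLp (S.indicator (cas t)) 2 ν :=
    fun hS t => (memLp_cas ν t).indicator hS
  have hinner : ∀ {S : Set ℝ} (hS : MeasurableSet S) (a b : ℝ),
      inner ℝ (hmem hS a).toLp (hmem hS b).toLp = ∫ x, cas a x * cas b x ∂(ν.restrict S) := by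
    intro S hS a b
    rw [L2.inner_def, ← integral_indicator hS]
    apply integral_congr_ae
    filter_upwards [(hmem hS a).coeFn_toLp, (hmem hS b).coeFn_toLp] with x e1 e2
    rw [e1, e2]
    by_cases hx : x ∈ S <;> simp [hx, mul_comm]
  refine inner_eq_zero_of_gram (α := fun t => (hmem hN.compl t).toLp)
    (β := fun t => (hmem hN t).toLp) ?_ ?_ ?_ ?_ hvw
  · intro a b
    rw [hv, hinner hN.compl, hr1, integral_cas_mul_cas h₁]
  · intro a b
    rw [hw, hinner hN, hr2, integral_cas_mul_cas h₂]
    congr 1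
    ext x
    rw [← Real.cos_neg]
    ring_nf
  · intro a b
    rw [L2.inner_def]
    refine integral_eq_zero_of_ae ?_
    filter_upwards [(hmem hN.compl a).coeFn_toLp, (hmem hN b).coeFn_toLp] with x e1 e2
    rw [e1, e2]
    by_cases hx : x ∈ N <;> simp [hx]
  · have : (fun t => (hmem hN.compl t).toLp + (hmem hN t).toLp) = casLp ν := by
      ext1 t
      rw [← MemLp.toLp_add]
      unfold casLp
      congr 1
      rw [add_comm]
      exact indicator_self_add_compl N (cas t)
    rw [this, topologicalClosure_span_casLp]
    trivial

/-! ### Koopman operators and spectral measures -/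

/-- The Koopman operator `F ↦ F ∘ φ` of a measure preserving map, on real `L²`. -/
noncomputable abbrev koopman {X Y : Type*} [MeasurableSpace X] [MeasurableSpace Y] {μ : Measure X}
    {ν : Measure Y} {φ : X → Y} (hφ : MeasurePreserving φ μ ν) : Lp ℝ 2 ν →ₗᵢ[ℝ] Lp ℝ 2 μ :=
  Lp.compMeasurePreservingₗᵢ ℝ φ hφ

lemma koopman_ae {X Y : Type*} [MeasurableSpace X] [MeasurableSpace Y] {μ : Measure X}
    {ν : Measure Y} {φ : X → Y} (hφ : MeasurePreserving φ μ ν) (F : Lp ℝ 2 ν) :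
    ∀ᵐ x ∂μ, koopman hφ F x = F (φ x) :=
  Lp.coeFn_compMeasurePreserving F hφ

lemma koopman_koopman {X Y Z : Type*} [MeasurableSpace X] [MeasurableSpace Y] [MeasurableSpace Z]
    {μ : Measure X} {ν : Measure Y} {κ : Measure Z} {φ : X → Y} {ψ : Y → Z}
    (hφ : MeasurePreserving φ μ ν) (hψ : MeasurePreserving ψ ν κ) (F : Lp ℝ 2 κ) :
    koopman hφ (koopman hψ F) = koopman (hψ.comp hφ) F :=
  (Lp.compMeasurePreserving_comp_apply F hψ hφ).symm

lemma koopman_congr {X Y : Type*} [MeasurableSpace X] [MeasurableSpace Y] {μ : Measure X}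
    {ν : Measure Y} {φ ψ : X → Y} (hφ : MeasurePreserving φ μ ν) (hψ : MeasurePreserving ψ μ ν)
    (h : φ =ᵐ[μ] ψ) (F : Lp ℝ 2 ν) : koopman hφ F = koopman hψ F := by
  apply Lp.ext
  filter_upwards [koopman_ae hφ F, koopman_ae hψ F, h] with x h1 h2 h3
  rw [h1, h2, h3]

variable {X : Type*} [MeasurableSpace X] {μ : Measure X}

/-- The orbit `t ↦ F ∘ T_t` of a vector of `L²(μ)` under a flow. -/
noncomputable def Flow.orbit (T : Flow μ) (F : Lp ℝ 2 μ) (t : ℝ) : Lp ℝ 2 μ :=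
  koopman (T.measurePreserving t) F

/-- `σ` is the spectral measure of the vector `F` under the flow `T`. For symmetric `σ`, the cosine
transform is the full Fourier transform. -/
def Flow.HasSpectralMeasure (T : Flow μ) (F : Lp ℝ 2 μ) (σ : Measure ℝ) : Prop :=
  ∀ a b, inner ℝ (T.orbit F a) (T.orbit F b) = ∫ x, Real.cos ((b - a) * x) ∂σ

lemma Flow.orbit_zero (T : Flow μ) (F : Lp ℝ 2 μ) : T.orbit F 0 = F := by
  unfold Flow.orbit
  rw [koopman_congr (T.measurePreserving 0) (MeasurePreserving.id μ) (ae_of_all _ T.map_zero)]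
  exact Lp.compMeasurePreserving_id_apply F

lemma Flow.koopman_orbit (T : Flow μ) (F : Lp ℝ 2 μ) (a b : ℝ) :
    koopman (T.measurePreserving a) (T.orbit F b) = T.orbit F (a + b) := by
  unfold Flow.orbit
  rw [koopman_koopman]
  apply koopman_congr
  filter_upwards with x
  rw [add_comm, T.map_add]
  rfl

lemma Flow.inner_orbit_orbit (T : Flow μ) (F F' : Lp ℝ 2 μ) (a b : ℝ) :
    inner ℝ (T.orbit F a) (T.orbit F' b) = inner ℝ (T.orbit F 0) (T.orbit F' (b - a)) := by
  rw [← LinearIsometry.inner_map_map (koopman (T.measurePreserving a)) (T.orbit F 0),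
    T.koopman_orbit, T.koopman_orbit, add_zero, add_sub_cancel]

lemma Flow.HasSpectralMeasure.continuous_orbit {T : Flow μ} {F : Lp ℝ 2 μ} {σ : Measure ℝ}
    [IsFiniteMeasure σ] (h : T.HasSpectralMeasure F σ) : Continuous (T.orbit F) := by
  have hC : Continuous fun t : ℝ => ∫ x, Real.cos (t * x) ∂σ := by
    refine continuous_of_dominated (bound := fun _ => 1) (fun t => by fun_prop)
      (fun t => ae_of_all _ fun x => Real.abs_cos_le_one _) (integrable_const 1)
      (ae_of_all _ fun x => by fun_prop)
  have hnorm : ∀ a b, ‖T.orbit F a - T.orbit F b‖ ^ 2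
      = 2 * (∫ x, Real.cos (0 * x) ∂σ) - 2 * ∫ x, Real.cos ((b - a) * x) ∂σ := by
    intro a b
    rw [norm_sub_sq_real, ← real_inner_self_eq_norm_sq, ← real_inner_self_eq_norm_sq, h, h, h,
      sub_self, sub_self]
    ring
  rw [continuous_iff_continuousAt]
  intro b
  rw [ContinuousAt, tendsto_iff_norm_sub_tendsto_zero]
  have h1 : Tendsto (fun a => ‖T.orbit F a - T.orbit F b‖ ^ 2) (nhds b) (nhds 0) := by
    simp_rw [hnorm]
    have : Continuous fun a : ℝ => 2 * (∫ x, Real.cos (0 * x) ∂σ)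
        - 2 * ∫ x, Real.cos ((b - a) * x) ∂σ :=
      continuous_const.sub (continuous_const.mul (hC.comp (continuous_const.sub continuous_id)))
    convert this.tendsto b using 2
    simp
  have h2 := (Real.continuous_sqrt.tendsto 0).comp h1
  simpa [Function.comp_def, Real.sqrt_sq (norm_nonneg _)] using h2

/-- A Gaussian flow has a vector with spectral measure `σ`, the generator of the Gaussian
process. -/
lemma hasSpectralMeasure_of_covariance {T : Flow μ} {σ : Measure ℝ} [IsFiniteMeasure σ] {f : X → ℝ}
    (hf : MemLp f 2 μ) (hcov : ∀ a b : ℝ,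
      ((∫ x, f (T.toFun a x) * f (T.toFun b x) ∂μ : ℝ) : ℂ) = charFun σ (b - a)) :
    T.HasSpectralMeasure hf.toLp σ := by
  intro a b
  rw [← charFun_re, ← hcov, Complex.ofReal_re, L2.inner_def]
  apply integral_congr_ae
  filter_upwards [koopman_ae (T.measurePreserving a) hf.toLp,
    koopman_ae (T.measurePreserving b) hf.toLp,
    (T.measurePreserving a).quasiMeasurePreserving.ae hf.coeFn_toLp,
    (T.measurePreserving b).quasiMeasurePreserving.ae hf.coeFn_toLp] with x h1 h2 h3 h4
  simp only [Flow.orbit, h1, h2, h3, h4]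
  simp [mul_comm]

lemma inner_eq_zero_of_hasSpectralMeasure {T : Flow μ} {σ₁ σ₂ : Measure ℝ} [IsFiniteMeasure σ₁]
    [IsFiniteMeasure σ₂] (h₁ : σ₁.map (fun x => -x) = σ₁) (h₂ : σ₂.map (fun x => -x) = σ₂)
    (hs : σ₁ ⟂ₘ σ₂) {F₁ F₂ : Lp ℝ 2 μ} (hF₁ : T.HasSpectralMeasure F₁ σ₁)
    (hF₂ : T.HasSpectralMeasure F₂ σ₂) : inner ℝ F₁ F₂ = 0 := by
  have := inner_eq_zero_of_mutuallySingular h₁ h₂ hs hF₁ hF₂ (T.inner_orbit_orbit F₁ F₂)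
  rwa [T.orbit_zero, T.orbit_zero] at this

/-- If `s` is a self-similarity of `T`, then every dilate by `s⁻¹` of a spectral measure of `T` is a
spectral measure of `T`. -/
lemma Flow.HasSpectralMeasure.dilate {T : Flow μ} {F : Lp ℝ 2 μ} {σ : Measure ℝ}
    (hF : T.HasSpectralMeasure F σ) {s : ℝˣ} (hs : s ∈ T.selfSimilarities) :
    ∃ F', T.HasSpectralMeasure F' (σ.map fun x => (s : ℝ)⁻¹ * x) := by
  obtain ⟨φ, -, hφ, -, -, -, heq⟩ := hs
  have horb : ∀ a, T.orbit (koopman hφ F) a = koopman hφ (T.orbit F ((s : ℝ)⁻¹ * a)) := by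
    intro a
    unfold Flow.orbit
    rw [koopman_koopman, koopman_koopman]
    apply koopman_congr
    filter_upwards [heq ((s : ℝ)⁻¹ * a)] with x hx
    simpa [Flow.scale] using hx
  refine ⟨koopman hφ F, fun a b => ?_⟩
  rw [horb, horb, LinearIsometry.inner_map_map, hF, integral_map (by fun_prop) (by fun_prop)]
  congr 1
  ext x
  congr 1
  ring

lemma countable_of_orthonormal {H ι : Type*} [NormedAddCommGroup H] [InnerProductSpace ℝ H]
    [TopologicalSpace.SeparableSpace H] {e : ι → H} (he : Orthonormal ℝ e) : Countable ι := by
  refine Pairwise.countable_of_isOpen_disjoint (s := fun i => Metric.ball (e i) (1 / 2)) ?_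
    (fun i => Metric.isOpen_ball) (fun i => Metric.nonempty_ball.2 (by norm_num))
  intro i j hij
  apply Metric.ball_disjoint_ball
  have h1 : ‖e i - e j‖ ^ 2 = 2 := by
    rw [norm_sub_sq_real, he.1, he.1, he.2 hij]
    norm_num
  rw [dist_eq_norm]
  nlinarith [norm_nonneg (e i - e j)]

/-! ### A flow with too few self-similarities -/

lemma countable_quotient_of_subset_selfSimilarities
    {π : ℝ →+ UnitAddCircle} (hπ_cont : Continuous π) (hπ_surj : Function.Surjective π)
    {ϑ : AddChar ℝ ℝ} (hϑ_cont : Continuous ϑ) (hϑ_bij : Set.BijOn ϑ Set.univ (Set.Ioi 0))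
    {ρ : Measure UnitAddCircle} [IsProbabilityMeasure ρ]
    (hρ_ergodic : IsErgodicUnderQuasiInvariance ρ)
    {ρ' : Measure ℝ} (hρ' : IsStandardLift π ρ ρ')
    {σ : Measure ℝ} (hσ : IsSymmetricExtension ϑ ρ' σ)
    [StandardBorelSpace X] [IsProbabilityMeasure μ] {T : Flow μ} {F : Lp ℝ 2 μ}
    (hF : T.HasSpectralMeasure F σ) (hT : {s : ℝˣ | 0 < (s : ℝ)} ⊆ T.selfSimilarities)
    {Q : Type*} {z : Q → UnitAddCircle} (hz : Pairwise fun c d =>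
      ¬ MeasureEquiv (ρ.map (fun x => z c + x)) (ρ.map (fun x => z d + x))) : Countable Q := by
  have := hσ.isProbabilityMeasure
  have hpos : ∀ u, 0 < ϑ u := fun u => hϑ_bij.mapsTo (mem_univ u)
  choose u hu using fun c => hπ_surj (z c)
  have hex : ∀ c, ∃ F', T.HasSpectralMeasure F' (σ.map fun x => ϑ (u c) * x) := by
    intro c
    have h := hF.dilate (hT (show 0 < ((Units.mk0 (ϑ (- u c)) (hpos _).ne' : ℝˣ) : ℝ) from hpos _))
    simpa [AddChar.map_neg_eq_inv] using h
  choose e he using hex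
  have hfin : ∀ c, IsProbabilityMeasure (σ.map fun x => ϑ (u c) * x) := fun c =>
    Measure.isProbabilityMeasure_map (by fun_prop)
  have : Fact ((2 : ℝ≥0∞) ≠ ∞) := ⟨ENNReal.ofNat_ne_top⟩
  refine countable_of_orthonormal (e := e) ⟨fun c => ?_, fun c d hcd => ?_⟩
  · have h := he c 0 0
    simp only [T.orbit_zero, sub_self, zero_mul, Real.cos_zero, integral_const, smul_eq_mul,
      mul_one, probReal_univ, real_inner_self_eq_norm_sq] at h
    exact (pow_eq_one_iff_of_nonneg (norm_nonneg _) two_ne_zero).1 h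
  · have hsing := (measureEquiv_or_mutuallySingular_map_add hρ_ergodic (z c) (z d)).resolve_left
      (hz hcd)
    rw [← hu c, ← hu d] at hsing
    exact inner_eq_zero_of_hasSpectralMeasure (map_const_mul_neg hσ.symmetric _)
      (map_const_mul_neg hσ.symmetric _)
      (mutuallySingular_dilates hπ_cont hϑ_cont hϑ_bij hρ' hσ hsing) (he c) (he d)

/-- Countably many cosets of the meagre group `H(τ)` cannot cover the group, so the translates of
`τ` fall into uncountably many equivalence classes. -/
lemma exists_uncountable_pairwise_not_measureEquiv.{u} {G : Type u} [AddCommGroup G]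
    [TopologicalSpace G] [IsTopologicalAddGroup G] [BaireSpace G] [MeasurableSpace G]
    [BorelSpace G] {τ : Measure G} (hτ : IsMeagre (quasiInvariance τ)) :
    ∃ (Q : Type u) (z : Q → G), ¬ Countable Q ∧ Pairwise fun c d =>
      ¬ MeasureEquiv (τ.map (fun x => z c + x)) (τ.map (fun x => z d + x)) := by
  let S : Setoid G :=
    { r := fun a b => MeasureEquiv (τ.map (fun x => a + x)) (τ.map (fun x => b + x))
      iseqv := ⟨fun _ => ⟨.rfl, .rfl⟩, MeasureEquiv.symm, MeasureEquiv.trans⟩ }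
  refine ⟨Quotient S, fun c => c.out, fun hc => ?_, fun c d hcd h => ?_⟩
  · have hcover : (⋃ c : Quotient S, (fun x => x - c.out) ⁻¹' quasiInvariance τ) = univ := by
      rw [eq_univ_iff_forall]
      intro a
      refine mem_iUnion.2 ⟨Quotient.mk S a, ?_⟩
      exact sub_mem_quasiInvariance_of_measureEquiv (Quotient.mk_out (s := S) a).symm
    have hmeagre : IsMeagre (univ : Set G) := by
      rw [← hcover]
      refine isMeagre_iUnion fun c => ?_
      exact hτ.preimage_of_isOpenMap (by fun_prop) (Homeomorph.subRight c.out).isOpenMap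
    exact not_isMeagre_of_isOpen isOpen_univ univ_nonempty hmeagre
  · apply hcd
    rw [← Quotient.out_eq c, ← Quotient.out_eq d]
    exact Quotient.sound h

/-! ### Point realizations of maps that generate the σ-algebra mod null sets -/

section Factor

variable {X Y : Type*} [MeasurableSpace X] [MeasurableSpace Y] {μ : Measure X}

/-- A measurable map out of a standard Borel space that generates the σ-algebra mod null sets has a
measurable left inverse mod null sets. Embedding `X` into `ℕ → Bool` reduces this to countably many
sets. -/
lemma exists_measurable_leftInverse_ae [StandardBorelSpace X] [Nonempty X] {F : X → Y}
    (hgen : ∀ A : Set X, MeasurableSet A → ∃ B : Set Y, MeasurableSet B ∧ A =ᵐ[μ] F ⁻¹' B) :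
    ∃ K : Y → X, Measurable K ∧ ∀ᵐ x ∂μ, K (F x) = x := by
  classical
  have hemb : MeasurableEmbedding (MeasurableSpace.mapNatBool X) :=
    (MeasurableSpace.measurable_mapNatBool X).measurableEmbedding
      (MeasurableSpace.injective_mapNatBool X)
  choose B hBm hB using fun n : ℕ => hgen ((fun x => MeasurableSpace.mapNatBool X x n) ⁻¹' {true})
    ((measurable_pi_iff.1 (MeasurableSpace.measurable_mapNatBool X) n) (measurableSet_singleton _))
  let h : Y → ℕ → Bool := fun y n => decide (y ∈ B n)
  have hh : Measurable h := by
    refine measurable_pi_iff.2 fun n => ?_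
    refine measurable_to_bool ?_
    convert hBm n using 1
    ext y
    simp [h]
  refine ⟨hemb.invFun ∘ h, hemb.measurable_invFun.comp hh, ?_⟩
  have hall : ∀ᵐ x ∂μ, ∀ n, (MeasurableSpace.mapNatBool X x n = true) = (F x ∈ B n) := by
    rw [ae_all_iff]
    exact fun n => hB n
  filter_upwards [hall] with x hx
  have : h (F x) = MeasurableSpace.mapNatBool X x := by
    ext1 n
    rw [Bool.eq_iff_iff]
    simp [h, hx n]
  rw [Function.comp_apply, this]
  exact hemb.leftInverse_invFun x

/-- Two generating maps with the same law differ by an automorphism of the probability space. -/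
lemma exists_automorphism_of_map_eq [StandardBorelSpace X] [Nonempty X] [MeasurableEq Y]
    {F G : X → Y} (hFm : Measurable F) (hGm : Measurable G)
    (hF : ∀ A : Set X, MeasurableSet A → ∃ B : Set Y, MeasurableSet B ∧ A =ᵐ[μ] F ⁻¹' B)
    (hG : ∀ A : Set X, MeasurableSet A → ∃ B : Set Y, MeasurableSet B ∧ A =ᵐ[μ] G ⁻¹' B)
    (hlaw : μ.map F = μ.map G) :
    ∃ φ ψ : X → X, MeasurePreserving φ μ μ ∧ MeasurePreserving ψ μ μ ∧
      (∀ᵐ x ∂μ, ψ (φ x) = x) ∧ (∀ᵐ x ∂μ, φ (ψ x) = x) ∧ ∀ᵐ x ∂μ, G (φ x) = F x := by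
  obtain ⟨KF, hKF, hKF'⟩ := exists_measurable_leftInverse_ae hF
  obtain ⟨KG, hKG, hKG'⟩ := exists_measurable_leftInverse_ae hG
  -- By equality of the laws, `F` takes almost all its values where `KG` inverts `G`.
  have transfer : ∀ {F G : X → Y} {KG : Y → X}, Measurable F → Measurable G → Measurable KG →
      (∀ᵐ x ∂μ, KG (G x) = x) → μ.map F = μ.map G → ∀ᵐ x ∂μ, G (KG (F x)) = F x := by
    intro F G KG hFm hGm hKG hKG' hlaw
    have hm : MeasurableSet {y | G (KG y) = y} :=
      measurableSet_eq_fun (hGm.comp hKG) measurable_id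
    have h1 : ∀ᵐ y ∂(μ.map G), G (KG y) = y := by
      rw [ae_map_iff hGm.aemeasurable hm]
      filter_upwards [hKG'] with x hx
      rw [hx]
    rw [← hlaw, ae_map_iff hFm.aemeasurable hm] at h1
    exact h1
  have hmp : ∀ {F G : X → Y} {KG : Y → X}, Measurable F → Measurable G → Measurable KG →
      (∀ᵐ x ∂μ, KG (G x) = x) → μ.map F = μ.map G → MeasurePreserving (KG ∘ F) μ μ := by
    intro F G KG hFm hGm hKG hKG' hlaw
    refine ⟨hKG.comp hFm, ?_⟩
    rw [← Measure.map_map hKG hFm, hlaw, Measure.map_map hKG hGm]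
    have : KG ∘ G =ᵐ[μ] id := hKG'
    rw [Measure.map_congr this, Measure.map_id]
  have h1 := transfer hFm hGm hKG hKG' hlaw
  have h2 := transfer hGm hFm hKF hKF' hlaw.symm
  refine ⟨KG ∘ F, KF ∘ G, hmp hFm hGm hKG hKG' hlaw, hmp hGm hFm hKF hKF' hlaw.symm, ?_, ?_, h1⟩
  · filter_upwards [h1, hKF'] with x e1 e2
    simp only [Function.comp_apply, e1, e2]
  · filter_upwards [h2, hKG'] with x e1 e2
    simp only [Function.comp_apply, e1, e2]

end Factor

/-! ### Gaussian Hilbert spaces -/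

section GaussianSpace

variable {X : Type*} [MeasurableSpace X] {μ : Measure X} [IsProbabilityMeasure μ]

/-- The characteristic functional `Z ↦ 𝔼 exp (i Z)` is continuous on `L²`. -/
lemma continuous_integral_exp :
    Continuous fun Z : Lp ℝ 2 μ => ∫ x, Complex.exp (Z x * Complex.I) ∂μ := by
  have hint : ∀ Z : Lp ℝ 2 μ, Integrable (fun x => Complex.exp (Z x * Complex.I)) μ := fun Z =>
    Integrable.of_bound
      (by
        have := (Lp.stronglyMeasurable Z).measurable
        fun_prop) 1
      (ae_of_all _ fun x => (Complex.norm_exp_ofReal_mul_I _).le)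
  refine LipschitzWith.continuous (K := 1) (LipschitzWith.of_dist_le_mul fun Z W => ?_)
  rw [dist_eq_norm, ← integral_sub (hint Z) (hint W), NNReal.coe_one, one_mul, dist_eq_norm]
  have hZW : Integrable (fun x => ‖(Z - W) x‖) μ :=
    ((Lp.memLp (Z - W)).integrable one_le_two).norm
  calc ‖∫ x, (Complex.exp (Z x * Complex.I) - Complex.exp (W x * Complex.I)) ∂μ‖
      ≤ ∫ x, ‖(Z - W) x‖ ∂μ := by
        refine norm_integral_le_of_norm_le hZW ?_
        filter_upwards [Lp.coeFn_sub Z W] with x hx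
        rw [hx, Pi.sub_apply]
        have : Complex.exp (Z x * Complex.I) - Complex.exp (W x * Complex.I)
            = Complex.exp (W x * Complex.I) *
              (Complex.exp (Complex.I * ((Z x - W x : ℝ) : ℂ)) - 1) := by
          rw [mul_sub, ← Complex.exp_add, mul_one]
          congr 2
          push_cast
          ring
        rw [this, norm_mul, Complex.norm_exp_ofReal_mul_I, one_mul]
        exact Real.norm_exp_I_mul_ofReal_sub_one_le
    _ = (eLpNorm (Z - W : Lp ℝ 2 μ) 1 μ).toReal := by
        rw [eLpNorm_one_eq_lintegral_enorm, integral_norm_eq_lintegral_enorm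
          (Lp.aestronglyMeasurable _)]
    _ ≤ ‖Z - W‖ := by
        rw [Lp.norm_def]
        exact ENNReal.toReal_mono (Lp.eLpNorm_ne_top _)
          (eLpNorm_le_eLpNorm_of_exponent_le one_le_two (Lp.aestronglyMeasurable _))

/-- All elements of the closed span of a centered Gaussian process are centered Gaussian. -/
lemma integral_exp_of_mem_closure {ι : Type*} {f : ι → X → ℝ} (hG : IsGaussianProcess f μ)
    (h0 : ∀ i, ∫ x, f i x ∂μ = 0) {W : ι → Lp ℝ 2 μ} (hW : ∀ i, W i =ᵐ[μ] f i) {Z : Lp ℝ 2 μ}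
    (hZ : Z ∈ (Submodule.span ℝ (range W)).topologicalClosure) :
    ∫ x, Complex.exp (Z x * Complex.I) ∂μ = Complex.exp (-(‖Z‖ ^ 2 / 2 : ℝ)) := by
  rw [← SetLike.mem_coe, Submodule.topologicalClosure_coe] at hZ
  refine closure_minimal (t := {Z : Lp ℝ 2 μ | ∫ x, Complex.exp (Z x * Complex.I) ∂μ
    = Complex.exp (-(‖Z‖ ^ 2 / 2 : ℝ))}) ?_
    (isClosed_eq continuous_integral_exp (by fun_prop)) hZ
  intro Z hZ
  rw [SetLike.mem_coe, ← Finsupp.range_linearCombination] at hZ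
  obtain ⟨c, rfl⟩ := hZ
  set Z := Finsupp.linearCombination ℝ W c with hZdef
  have hZae : Z =ᵐ[μ] fun x => ∑ i ∈ c.support, (c i • f i) x := by
    rw [hZdef, Finsupp.linearCombination_apply, Finsupp.sum]
    have h1 := Lp.coeFn_finsetSum c.support (fun i => c i • W i)
    have h2 : ∀ᵐ x ∂μ, ∀ i ∈ c.support, (c i • W i : Lp ℝ 2 μ) x = (c i • f i) x := by
      refine (Finset.eventually_all _).2 fun i _ => ?_
      filter_upwards [Lp.coeFn_smul (c i) (W i), hW i] with x e1 e2
      simp [e1, e2]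
    filter_upwards [h1, h2] with x e1 e2
    rw [e1, Finset.sum_apply]
    exact Finset.sum_congr rfl e2
  have hgauss : HasGaussianLaw Z μ :=
    (((hG.smul fun i => c i).hasGaussianLaw_fun_sum (I := c.support))).congr hZae.symm
  have hmean : ∫ x, Z x ∂μ = 0 := by
    rw [integral_congr_ae hZae, integral_finsetSum]
    · refine Finset.sum_eq_zero fun i _ => ?_
      simp only [Pi.smul_apply, smul_eq_mul, integral_const_mul, h0, mul_zero]
    · exact fun i _ => ((hG.hasGaussianLaw_eval i).integrable).smul (c i)
  have hvar : Var[Z; μ] = ‖Z‖ ^ 2 := by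
    rw [variance_of_integral_eq_zero hgauss.aemeasurable hmean, ← real_inner_self_eq_norm_sq,
      L2.inner_def]
    congr 1
    ext x
    simp [sq]
  have h1 := hgauss.charFun_map_eq 1
  rw [charFun_apply, integral_map hgauss.aemeasurable (by fun_prop)] at h1
  simp only [RCLike.inner_apply, conj_trivial, one_mul, mul_one] at h1
  rw [mem_ofPred_eq, h1, hmean, hvar]
  simp

/-- Gaussian families in a common Gaussian Hilbert space with equal covariances have equal laws. -/
lemma map_eq_of_inner_eq {ι κ : Type*} {f : ι → X → ℝ} (hG : IsGaussianProcess f μ)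
    (h0 : ∀ i, ∫ x, f i x ∂μ = 0) {W : ι → Lp ℝ 2 μ} (hW : ∀ i, W i =ᵐ[μ] f i)
    {V V' : κ → Lp ℝ 2 μ} (hV : ∀ k, V k ∈ (Submodule.span ℝ (range W)).topologicalClosure)
    (hV' : ∀ k, V' k ∈ (Submodule.span ℝ (range W)).topologicalClosure)
    (h : ∀ j k, inner ℝ (V j) (V k) = inner ℝ (V' j) (V' k)) :
    μ.map (fun x k => V k x) = μ.map (fun x k => V' k x) := by
  classical
  have hm : ∀ V : κ → Lp ℝ 2 μ, Measurable fun x k => V k x := fun V =>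
    measurable_pi_iff.2 fun k => (Lp.stronglyMeasurable (V k)).measurable
  have := Measure.isProbabilityMeasure_map (μ := μ) (hm V).aemeasurable
  refine IsProjectiveLimit.unique (P := fun I => (μ.map fun x k => V k x).map I.restrict)
    (fun I => rfl) fun I => ?_
  have := Measure.isProbabilityMeasure_map (μ := μ) (hm V').aemeasurable
  have hr : Measurable (I.restrict (π := fun _ : κ => ℝ)) := Finset.measurable_restrict I
  have := Measure.isProbabilityMeasure_map (μ := μ.map fun x k => V k x) hr.aemeasurable
  have := Measure.isProbabilityMeasure_map (μ := μ.map fun x k => V' k x) hr.aemeasurable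
  apply Measure.ext_of_charFunDual
  ext L
  have key : ∀ V : κ → Lp ℝ 2 μ, (∀ k, V k ∈ (Submodule.span ℝ (range W)).topologicalClosure) →
      charFunDual ((μ.map fun x k => V k x).map I.restrict) L
        = Complex.exp (-(‖∑ k : I, L (Pi.single k 1) • V k‖ ^ 2 / 2 : ℝ)) := by
    intro V hV
    have hmem : (∑ k : I, L (Pi.single k 1) • V k) ∈
        (Submodule.span ℝ (range W)).topologicalClosure :=
      Submodule.sum_mem _ fun k _ => Submodule.smul_mem _ _ (hV k)
    rw [charFunDual_apply, Measure.map_map hr (hm V),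
      integral_map (hr.comp (hm V)).aemeasurable (by fun_prop),
      ← integral_exp_of_mem_closure hG h0 hW hmem]
    apply integral_congr_ae
    have h1 := Lp.coeFn_finsetSum Finset.univ (fun k : I => L (Pi.single k 1) • V k)
    have h2 : ∀ᵐ x ∂μ, ∀ k : I, (L (Pi.single k 1) • V k : Lp ℝ 2 μ) x
        = L (Pi.single k 1) * V k x := by
      rw [ae_all_iff]
      intro k
      filter_upwards [Lp.coeFn_smul (L (Pi.single k 1)) (V k)] with x e
      simp [e]
    filter_upwards [h1, h2] with x e1 e2
    rw [e1, Finset.sum_apply, Finset.sum_congr rfl (fun k _ => e2 k)]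
    congr 3
    refine (LinearMap.pi_apply_eq_sum_univ L.toLinearMap _).trans
      (Finset.sum_congr rfl fun k _ => ?_)
    have : (fun j => if k = j then (1 : ℝ) else 0) = Pi.single k 1 := by
      ext j
      simp [Pi.single_apply, eq_comm]
    rw [this, smul_eq_mul, mul_comm]
    rfl
  rw [key V hV, key V' hV']
  have hnorm : ‖∑ k : I, L (Pi.single k 1) • V k‖ ^ 2 = ‖∑ k : I, L (Pi.single k 1) • V' k‖ ^ 2 := by
    rw [← real_inner_self_eq_norm_sq, ← real_inner_self_eq_norm_sq]
    simp only [sum_inner, inner_sum, real_inner_smul_left, real_inner_smul_right, h]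
  rw [hnorm]

end GaussianSpace

/-! ### Generating families in `L²` -/

lemma aestronglyMeasurable_of_mem_closure {X κ : Type*} {m m0 : MeasurableSpace X} {μ : Measure X}
    (hm : m ≤ m0) {V : κ → Lp ℝ 2 μ} (hV : ∀ k, AEStronglyMeasurable[m] (V k) μ) {F : Lp ℝ 2 μ}
    (hF : F ∈ (Submodule.span ℝ (range V)).topologicalClosure) : AEStronglyMeasurable[m] F μ := by
  have h2 : Submodule.span ℝ (range V) ≤ lpMeas ℝ ℝ m 2 μ := by
    rw [Submodule.span_le]
    rintro _ ⟨k, rfl⟩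
    exact mem_lpMeas_iff_aestronglyMeasurable.2 (hV k)
  rw [← SetLike.mem_coe, Submodule.topologicalClosure_coe] at hF
  exact closure_minimal (fun F hF => mem_lpMeas_iff_aestronglyMeasurable.1 (h2 hF))
    (isClosed_aestronglyMeasurable hm) hF

/-- A countable family of `L²` functions whose closed span contains a generating family of functions
is itself generating. -/
lemma generates_of_mem_closure {X ι κ : Type*} [MeasurableSpace X] {μ : Measure X} [Countable κ]
    {f : ι → X → ℝ} (hgen : ∀ A : Set X, MeasurableSet A → ∃ B : Set X,
      MeasurableSet[⨆ i, MeasurableSpace.comap (f i) inferInstance] B ∧ A =ᵐ[μ] B)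
    {W : ι → Lp ℝ 2 μ} (hW : ∀ i, W i =ᵐ[μ] f i) {V : κ → Lp ℝ 2 μ}
    (hV : ∀ i, W i ∈ (Submodule.span ℝ (range V)).topologicalClosure) (A : Set X)
    (hA : MeasurableSet A) :
    ∃ B : Set (κ → ℝ), MeasurableSet B ∧ A =ᵐ[μ] (fun x k => V k x) ⁻¹' B := by
  have hΦm : Measurable (fun x k => V k x) :=
    measurable_pi_iff.2 fun k => (Lp.stronglyMeasurable (V k)).measurable
  have hVm : ∀ k, AEStronglyMeasurable[MeasurableSpace.comap (fun x k => V k x) inferInstance]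
      (V k) μ := by
    intro k
    have := (measurable_pi_apply (X := fun _ : κ => ℝ) k).comp
      (comap_measurable fun x k => V k x)
    exact this.stronglyMeasurable.aestronglyMeasurable
  have hWm : ∀ i, AEStronglyMeasurable[MeasurableSpace.comap (fun x k => V k x) inferInstance]
      (f i) μ := fun i =>
    (aestronglyMeasurable_of_mem_closure hΦm.comap_le hVm (hV i)).congr (hW i)
  have hsup : (⨆ i, MeasurableSpace.comap (f i) inferInstance) ≤
      eventuallyMeasurableSpace (MeasurableSpace.comap (fun x k => V k x) inferInstance)
        (ae μ) := by
    refine iSup_le fun i => ?_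
    rintro _ ⟨S, hS, rfl⟩
    obtain ⟨g, hg, hfg⟩ := hWm i
    exact ⟨g ⁻¹' S, hg.measurable hS, hfg.preimage S⟩
  obtain ⟨B, hB, hAB⟩ := hgen A hA
  obtain ⟨_, ⟨D, hD, rfl⟩, hBD⟩ := hsup B hB
  exact ⟨D, hD, hAB.trans hBD⟩

/-! ### Dilations that preserve the class of the spectral measure -/

/-- The function `k` is the square root of the density of the dilated measure `s σ` with respect
to `σ`; it is even because both measures are symmetric. -/
lemma exists_sqrt_density {σ : Measure ℝ} [IsFiniteMeasure σ] (hσ : σ.map (fun x => -x) = σ)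
    {s : ℝˣ} (hs : s ∈ mulQuasiInvariance σ) :
    ∃ k : ℝ → ℝ, Measurable k ∧ MemLp k 2 σ ∧ (∀ᵐ x ∂σ, k x ≠ 0) ∧ (∀ᵐ x ∂σ, k (-x) = k x) ∧
      ∀ g : ℝ → ℝ, ∫ x, k x * k x * g x ∂σ = ∫ x, g (s * x) ∂σ := by
  set σs := σ.map (fun x => (s : ℝ) * x) with hσs
  obtain ⟨h1, h2⟩ : σs ≪ σ ∧ σ ≪ σs := hs
  have hsq : ∀ x, √(σs.rnDeriv σ x).toReal * √(σs.rnDeriv σ x).toReal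
      = (σs.rnDeriv σ x).toReal := fun x => Real.mul_self_sqrt ENNReal.toReal_nonneg
  have hm : Measurable fun x => √(σs.rnDeriv σ x).toReal :=
    (Measure.measurable_rnDeriv σs σ).ennreal_toReal.sqrt
  refine ⟨fun x => √(σs.rnDeriv σ x).toReal, hm, ?_, ?_, ?_, fun g => ?_⟩
  · rw [memLp_two_iff_integrable_sq hm.aestronglyMeasurable]
    simp_rw [sq, hsq]
    exact Measure.integrable_toReal_rnDeriv
  · filter_upwards [h2.ae_le (Measure.rnDeriv_pos h1), Measure.rnDeriv_ne_top σs σ]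
      with x hx hx'
    exact (Real.sqrt_pos.2 (ENNReal.toReal_pos hx.ne' hx')).ne'
  · have h := (MeasurableEquiv.neg ℝ).measurableEmbedding.rnDeriv_map σs σ
    have e1 : σs.map (MeasurableEquiv.neg ℝ) = σs := map_const_mul_neg hσ s
    have e2 : σ.map (MeasurableEquiv.neg ℝ) = σ := hσ
    rw [e1, e2] at h
    filter_upwards [h] with x hx
    have hx' : σs.rnDeriv σ (-x) = σs.rnDeriv σ x := hx
    rw [hx']
  · simp_rw [hsq]
    have h := integral_rnDeriv_smul (f := g) h1
    simp only [smul_eq_mul] at h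
    rw [h, hσs]
    exact (MeasurableEquiv.mulLeft₀ (s : ℝ) s.ne_zero).measurableEmbedding.integral_map g

lemma integral_even_mul_cas_mul_cas {σ : Measure ℝ} [IsFiniteMeasure σ]
    (hσ : σ.map (fun x => -x) = σ) {k : ℝ → ℝ} (hk : MemLp k 2 σ)
    (heven : ∀ᵐ x ∂σ, k (-x) = k x) (a b : ℝ) :
    ∫ x, k x * cas a x * cas b x ∂σ = ∫ x, k x * Real.cos ((b - a) * x) ∂σ := by
  have hi : Integrable k σ := hk.integrable one_le_two
  simp_rw [mul_assoc, cas_mul_cas, mul_add]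
  rw [integral_add (hi.mul_bdd (c := 1) (by fun_prop) (ae_of_all _ fun x => Real.abs_cos_le_one _))
      (hi.mul_bdd (c := 1) (by fun_prop) (ae_of_all _ fun x => Real.abs_sin_le_one _)),
    integral_eq_zero_of_odd hσ (F := fun x => k x * Real.sin ((a + b) * x)), add_zero]
  filter_upwards [heven] with x hx
  rw [hx, mul_neg, Real.sin_neg, mul_neg]

variable {X : Type*} [MeasurableSpace X] {μ : Measure X}

/-- If `s` preserves the class of the spectral measure `σ` of `F`, then the cyclic space of `F`
contains a cyclic vector whose orbit has the covariance of the orbit of `F` run at speed `s`. It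
corresponds to the square root of the density of `s σ` in the spectral model `L²(σ)`. -/
lemma Flow.HasSpectralMeasure.exists_orbit_rescaled {T : Flow μ} {F : Lp ℝ 2 μ} {σ : Measure ℝ}
    [IsFiniteMeasure σ] (hF : T.HasSpectralMeasure F σ) (hσ : σ.map (fun x => -x) = σ)
    {s : ℝˣ} (hs : s ∈ mulQuasiInvariance σ) :
    ∃ G : Lp ℝ 2 μ,
      (∀ a b, inner ℝ (T.orbit G a) (T.orbit G b)
        = inner ℝ (T.orbit F (s * a)) (T.orbit F (s * b))) ∧
      (∀ t, T.orbit G t ∈ (Submodule.span ℝ (range (T.orbit F))).topologicalClosure) ∧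
      (∀ t, T.orbit F t ∈ (Submodule.span ℝ (range (T.orbit G))).topologicalClosure) := by
  obtain ⟨k, hkm, hk, hk0, heven, hdens⟩ := exists_sqrt_density hσ hs
  obtain ⟨U, hU⟩ := exists_linearIsometry_of_inner_eq (v := casLp σ) (w := T.orbit F)
    (fun a b => by rw [inner_casLp hσ, hF]) (topologicalClosure_span_casLp σ)
  set kc : ℝ → Lp ℝ 2 σ := fun t => (memLp_mul_cas hk t).toLp with hkc
  have hinner : ∀ t a, inner ℝ (casLp σ t) (kc a) = ∫ x, k x * Real.cos ((t - a) * x) ∂σ := by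
    intro t a
    rw [← integral_even_mul_cas_mul_cas hσ hk heven, L2.inner_def]
    apply integral_congr_ae
    filter_upwards [(memLp_cas σ t).coeFn_toLp, (memLp_mul_cas hk a).coeFn_toLp] with x h1 h2
    simp [casLp, hkc, h1, h2]
  -- In the spectral model the flow multiplies even functions by the Hartley kernel.
  have horbit : ∀ a, T.orbit (U (kc 0)) a = U (kc a) := by
    intro a
    apply eq_of_inner_eq_of_mem_topologicalClosure_span (w := T.orbit F)
    · have h := linearIsometry_apply_mem_topologicalClosure_span (topologicalClosure_span_casLp σ)
        (U := (koopman (T.measurePreserving a)).comp U) (w := fun t => T.orbit F (a + t))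
        (fun t => by
          change koopman _ (U _) = _
          rw [hU, T.koopman_orbit]) (kc 0)
      refine Submodule.topologicalClosure_mono (Submodule.span_mono ?_) h
      rintro _ ⟨t, rfl⟩
      exact ⟨a + t, rfl⟩
    · exact linearIsometry_apply_mem_topologicalClosure_span (topologicalClosure_span_casLp σ) hU _
    · intro t
      have h1 : T.orbit F t = koopman (T.measurePreserving a) (T.orbit F (t - a)) := by
        rw [T.koopman_orbit, add_sub_cancel]
      rw [← hU t, LinearIsometry.inner_map_map, hinner, hU t, h1]
      unfold Flow.orbit
      rw [LinearIsometry.inner_map_map]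
      change inner ℝ (T.orbit F (t - a)) _ = _
      rw [← hU, LinearIsometry.inner_map_map, hinner, sub_zero]
  refine ⟨U (kc 0), fun a b => ?_, fun t => ?_, fun t => ?_⟩
  · rw [horbit, horbit, LinearIsometry.inner_map_map, ← hU, ← hU, LinearIsometry.inner_map_map,
      inner_casLp hσ, ← integral_cas_mul_cas hσ, L2.inner_def]
    have h := hdens fun x => cas a x * cas b x
    have hscale : ∀ t x : ℝ, cas t (s * x) = cas (s * t) x := by
      intro t x
      unfold cas
      rw [← mul_assoc, mul_comm t]
    simp only [hscale] at h
    rw [← h]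
    apply integral_congr_ae
    filter_upwards [(memLp_mul_cas hk a).coeFn_toLp, (memLp_mul_cas hk b).coeFn_toLp] with x h1 h2
    simp only [hkc, h1, h2, RCLike.inner_apply, conj_trivial]
    ring
  · rw [horbit]
    exact linearIsometry_apply_mem_topologicalClosure_span (topologicalClosure_span_casLp σ) hU _
  · rw [← hU]
    exact linearIsometry_apply_mem_topologicalClosure_span
      (topologicalClosure_span_mul_cas hk hkm hk0) (fun a => (horbit a).symm) _

lemma mem_topologicalClosure_span_range_rat {H : Type*} [NormedAddCommGroup H] [NormedSpace ℝ H]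
    {u : ℝ → H} (hu : Continuous u) (t : ℝ) :
    u t ∈ (Submodule.span ℝ (range fun q : ℚ => u q)).topologicalClosure := by
  refine (Rat.denseRange_cast (𝕜 := ℝ)).induction_on
    (p := fun t => u t ∈ (Submodule.span ℝ (range fun q : ℚ => u q)).topologicalClosure) t ?_ ?_
  · exact (Submodule.isClosed_topologicalClosure _).preimage hu
  · exact fun q => Submodule.le_topologicalClosure _ (Submodule.subset_span ⟨q, rfl⟩)

lemma mem_topologicalClosure_span_range_rat_of_mem {H : Type*} [NormedAddCommGroup H]
    [NormedSpace ℝ H] {u : ℝ → H} (hu : Continuous u) {y : H}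
    (hy : y ∈ (Submodule.span ℝ (range u)).topologicalClosure) :
    y ∈ (Submodule.span ℝ (range fun q : ℚ => u q)).topologicalClosure := by
  refine Submodule.topologicalClosure_minimal _ (Submodule.span_le.2 ?_)
    (Submodule.isClosed_topologicalClosure _) hy
  rintro _ ⟨t, rfl⟩
  exact mem_topologicalClosure_span_range_rat hu t

/-- An automorphism that carries the orbit of `G` to the orbit of `F` at speed `s` intertwines the
flows, provided the functions `G ∘ T_q`, for rational `q`, separate points mod null sets. -/
lemma equivariant_of_orbit_eq {T : Flow μ} {F G : Lp ℝ 2 μ} (hFc : Continuous (T.orbit F))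
    (hGc : Continuous (T.orbit G)) {s : ℝ} {φ : X → X} (hφ : MeasurePreserving φ μ μ)
    {K : (ℚ → ℝ) → X} (hK : ∀ᵐ x ∂μ, K (fun q : ℚ => T.orbit G q x) = x)
    (hφG : ∀ᵐ x ∂μ, ∀ q : ℚ, T.orbit G q (φ x) = T.orbit F (s * q) x) (t : ℝ) :
    ∀ᵐ x ∂μ, φ (T.toFun (s * t) x) = T.toFun t (φ x) := by
  have hreal : (fun t => koopman hφ (T.orbit G t)) = fun t => T.orbit F (s * t) := by
    refine (Rat.denseRange_cast (𝕜 := ℝ)).equalizer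
      ((koopman hφ).continuous.comp hGc) (hFc.comp (continuous_const_mul s)) ?_
    ext1 q
    apply Lp.ext
    filter_upwards [koopman_ae hφ (T.orbit G q), hφG] with x h1 h2
    simp only [Function.comp_apply]
    rw [h1, h2]
  have hTs := T.measurePreserving (s * t)
  have hTt := T.measurePreserving t
  have e1 : ∀ᵐ x ∂μ, ∀ q : ℚ,
      T.orbit F (s * q) (T.toFun (s * t) x) = T.orbit F (s * (t + q)) x := by
    rw [ae_all_iff]
    intro q
    rw [mul_add, ← T.koopman_orbit]
    filter_upwards [koopman_ae hTs (T.orbit F (s * q))] with x hx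
    rw [hx]
  have e2 : ∀ᵐ x ∂μ, ∀ q : ℚ, T.orbit G q (T.toFun t (φ x)) = T.orbit F (s * (t + q)) x := by
    rw [ae_all_iff]
    intro q
    rw [← congrFun hreal (t + q), ← T.koopman_orbit]
    filter_upwards [hφ.quasiMeasurePreserving.ae (koopman_ae hTt (T.orbit G q)),
      koopman_ae hφ (koopman hTt (T.orbit G q))] with x h1 h2
    rw [h2, h1]
  filter_upwards [e1, e2, hTs.quasiMeasurePreserving.ae hφG,
    (hφ.comp hTs).quasiMeasurePreserving.ae hK, (hTt.comp hφ).quasiMeasurePreserving.ae hK]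
    with x h1 h2 h3 h4 h5
  rw [Function.comp_apply] at h4 h5
  rw [← h4, ← h5]
  congr 1
  ext1 q
  rw [h3, h1, h2]

lemma mulQuasiInvariance_subset_selfSimilarities [StandardBorelSpace X] [IsProbabilityMeasure μ]
    {σ : Measure ℝ} [IsFiniteMeasure σ] (hσ : σ.map (fun x => -x) = σ) {T : Flow μ}
    (hT : T.IsGaussianFlow σ) : mulQuasiInvariance σ ⊆ T.selfSimilarities := by
  intro s hs
  obtain ⟨f, hfm, hgauss, hmean, hcov, hgen⟩ := hT
  have hf : MemLp f 2 μ := by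
    have := (hgauss.hasGaussianLaw_eval 0).memLp_two
    simpa only [T.map_zero] using this
  have hF := hasSpectralMeasure_of_covariance hf hcov
  set F := hf.toLp with hFdef
  have hmean' : ∀ t, ∫ x, f (T.toFun t x) ∂μ = 0 := by
    intro t
    have h := integral_map (μ := μ) (T.measurePreserving t).measurable.aemeasurable
      (f := f) hfm.aestronglyMeasurable
    rw [(T.measurePreserving t).map_eq, hmean] at h
    exact h.symm
  have horb : ∀ t, T.orbit F t =ᵐ[μ] fun x => f (T.toFun t x) := by
    intro t
    filter_upwards [koopman_ae (T.measurePreserving t) F,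
      (T.measurePreserving t).quasiMeasurePreserving.ae hf.coeFn_toLp] with x h1 h2
    rw [Flow.orbit, h1, h2]
  obtain ⟨G, hGram, hGF, hFG⟩ := hF.exists_orbit_rescaled hσ hs
  have hFc := hF.continuous_orbit
  have hGspec : T.HasSpectralMeasure G (σ.map fun x => (s : ℝ) * x) := by
    intro a b
    rw [hGram, hF, integral_map (by fun_prop) (by fun_prop)]
    congr 1
    ext x
    congr 1
    ring
  have hGc := hGspec.continuous_orbit
  have hFsc : Continuous fun t : ℝ => T.orbit F (s * t) := hFc.comp (continuous_const_mul _)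
  have hX : Nonempty X := nonempty_of_isProbabilityMeasure μ
  have hgenF := generates_of_mem_closure hgen horb (V := fun q : ℚ => T.orbit F (s * q)) fun t => by
    have h := mem_topologicalClosure_span_range_rat hFsc ((s : ℝ)⁻¹ * t)
    rwa [mul_inv_cancel_left₀ s.ne_zero] at h
  have hgenG := generates_of_mem_closure hgen horb (V := fun q : ℚ => T.orbit G q) fun t =>
    mem_topologicalClosure_span_range_rat_of_mem hGc (hFG t)
  have hlaw := map_eq_of_inner_eq hgauss hmean' horb (V := fun q : ℚ => T.orbit F (s * q))
    (V' := fun q : ℚ => T.orbit G q)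
    (fun q => Submodule.le_topologicalClosure _ (Submodule.subset_span ⟨_, rfl⟩))
    (fun q => hGF q) (fun p q => (hGram p q).symm)
  have hmeas : ∀ V : ℚ → Lp ℝ 2 μ, Measurable fun x k => V k x := fun V =>
    measurable_pi_iff.2 fun k => (Lp.stronglyMeasurable (V k)).measurable
  obtain ⟨φ, ψ, hφ, hψ, h1, h2, h3⟩ :=
    exists_automorphism_of_map_eq (hmeas _) (hmeas _) hgenF hgenG hlaw
  obtain ⟨K, -, hK⟩ := exists_measurable_leftInverse_ae hgenG
  refine ⟨φ, ψ, hφ, hψ, h1, h2, fun t => ?_⟩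
  refine equivariant_of_orbit_eq hFc hGc hφ hK ?_ t
  filter_upwards [h3] with x hx q
  exact congrFun hx q

lemma not_pos_subset_selfSimilarities
    {π : ℝ →+ UnitAddCircle} (hπ_cont : Continuous π) (hπ_surj : Function.Surjective π)
    {ϑ : AddChar ℝ ℝ} (hϑ_cont : Continuous ϑ) (hϑ_bij : Set.BijOn ϑ Set.univ (Set.Ioi 0))
    {ρ : Measure UnitAddCircle} [IsProbabilityMeasure ρ]
    (hρ_meager : IsMeagre (quasiInvariance ρ)) (hρ_ergodic : IsErgodicUnderQuasiInvariance ρ)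
    {ρ' : Measure ℝ} (hρ' : IsStandardLift π ρ ρ')
    {σ : Measure ℝ} (hσ : IsSymmetricExtension ϑ ρ' σ)
    [StandardBorelSpace X] [IsProbabilityMeasure μ] {T : Flow μ} {F : Lp ℝ 2 μ}
    (hF : T.HasSpectralMeasure F σ) : ¬ ({s : ℝˣ | 0 < (s : ℝ)} ⊆ T.selfSimilarities) := by
  intro hT
  obtain ⟨Q, z, hQ, hz⟩ := exists_uncountable_pairwise_not_measureEquiv hρ_meager
  exact hQ (countable_quotient_of_subset_selfSimilarities hπ_cont hπ_surj hϑ_cont hϑ_bij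
    hρ_ergodic hρ' hσ hF hT hz)

end GaussianSelfSimilarity

theorem proposition1p1
    (π : ℝ →+ UnitAddCircle) (hπ_cont : Continuous π) (hπ_surj : Function.Surjective π)
    (ϑ : AddChar ℝ ℝ) (hϑ_cont : Continuous ϑ) (hϑ_bij : Set.BijOn ϑ Set.univ (Set.Ioi 0))
    (ρ : Measure UnitAddCircle) [IsProbabilityMeasure ρ] (hρ_nonatomic : ∀ z, ρ {z} = 0)
    (hρ_uncountable : ¬ (GaussianSelfSimilarity.quasiInvariance ρ).Countable)
    (hρ_meager : IsMeagre (GaussianSelfSimilarity.quasiInvariance ρ))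
    (hρ_ergodic : GaussianSelfSimilarity.IsErgodicUnderQuasiInvariance ρ)
    (ρ' : Measure ℝ) (hρ' : GaussianSelfSimilarity.IsStandardLift π ρ ρ')
    (σ : Measure ℝ) (hσ : GaussianSelfSimilarity.IsSymmetricExtension ϑ ρ' σ)
    {X : Type*} [MeasurableSpace X] [StandardBorelSpace X]
    (μ : Measure X) [IsProbabilityMeasure μ]
    (T : GaussianSelfSimilarity.Flow μ) (hT : T.IsGaussianFlow σ) :
    GaussianSelfSimilarity.mulQuasiInvariance σ ⊆ T.selfSimilarities ∧
      ¬ ({s : ℝˣ | 0 < (s : ℝ)} ⊆ T.selfSimilarities) := by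
  have := hσ.isProbabilityMeasure
  refine ⟨GaussianSelfSimilarity.mulQuasiInvariance_subset_selfSimilarities hσ.symmetric hT, ?_⟩
  obtain ⟨f, hfm, hgauss, hmean, hcov, hgen⟩ := hT
  have hf : MemLp f 2 μ := by
    have := (hgauss.hasGaussianLaw_eval 0).memLp_two
    simpa only [T.map_zero] using this
  exact GaussianSelfSimilarity.not_pos_subset_selfSimilarities hπ_cont hπ_surj hϑ_cont hϑ_bij
    hρ_meager hρ_ergodic hρ' hσ
    (GaussianSelfSimilarity.hasSpectralMeasure_of_covariance hf hcov)
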